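/- **Notation.** For a field $F$, the pre-Bloch group $\mathcal P(F)$ is the quotient of the free abelian group $\mathbb Z[F\setminus\{0,1\}]$ by the subgroup generated by the 5-term relations $$[x]-[y]+\Big[\frac yx\Big]-\Big[\frac{1-x^{-1}}{1-y^{-1}}\Big]+\Big[\frac{1-x}{1-y}\Big],\qquad x\neq y\in F\setminus\{0,1\}.$$ The Bloch–Wigner function is $D(x)=\arg(1-x)\log|x|-\operatorname{Im}\int_0^x\log(1-t)\,\frac{dt}{t}$ (the integral along the straight segment, with principal branches); $D([z])=D(z)$ defines a homomorphism $D:\mathcal P(\mathbb C)\to\mathbb R$. Let $\langle z,w\rangle=z_0\bar w_2+z_1\bar w_1+z_2\bar w_0$ on $\mathbb C^3$, let $S^3\subset\mathbb{CP}^2$ be the set of null lines, and let $G=PU(2,1)$. A $\mathbb C$-circle is the set of null lines contained in a complex plane of $\mathbb C^3$ on which the form takes a negative value. Points of $S^3$ are *generic* if they are distinct and no three of them lie on a $\mathbb C$-circle. For generic $(p_0,p_1,p_2,p_3)$ with lifts $v_i\in\mathbb C^3$ and $\{i,j,k,l\}=\{0,1,2,3\}$ put $$[i,j,k,l]=\frac{\langle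 v_l,v_i\boxtimes v_j\rangle\,\langle v_k,v_i\rangle}{\langle v_k,v_i\boxtimes v_j\rangle\,\langle v_l,v_i\rangle}\in\mathbb C\setminus\{0,1\},$$ where $v\boxtimes w=(\bar v_0\bar w_1-\bar v_1\bar w_0,\ \bar v_2\bar w_0-\bar v_0\bar w_2,\ \bar v_1\bar w_2-\bar v_2\bar w_1)$ is the Hermitian cross product, which is orthogonal to $v$ and $w$. Put $z_{01}=[0,1,2,3]$, $z_{10}=[1,0,3,2]$, $z_{23}=[2,3,0,1]$, $z_{32}=[3,2,1,0]$. Let $C_n(S^3)$ be the free abelian group on generic ordered $(n+1)$-tuples of points of $S^3$, with the alternating-sum differential $d_n:C_n(S^3)\to C_{n-1}(S^3)$ and the diagonal $G$-action, and let $\bar d_n:C_n(S^3)_G\to C_{n-1}(S^3)_G$ be the induced map on co-invariants. The formula $$c([p_0,p_1,p_2,p_3])=[z_{01}]+[z_{10}]+[z_{23}]+[z_{32}]$$ defines a homomorphism $c:C_3(S^3)_G/\operatorname{Im}(\bar d_4)\to\mathcal P(\mathbb C)$. A *spherical CR manifold* is a 3-manifold $M$ (without boundary) with an atlas of charts in $S^3$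 whose coordinate changes agree locally with elements of $PU(2,1)$. A *CR triangulation* of $M$ is a homeomorphism onto $M$ from a space obtained from finitely many tetrahedra $\Delta_1,\dots,\Delta_k$ by affinely gluing their faces in pairs (two faces of one tetrahedron may be glued); if $M$ is not compact the triangulation is ideal, i.e. all vertices are removed. Moreover each $\Delta_i$ has a continuous development $\Delta_i\to S^3$, defined also at the vertices and given by charts of $M$ near each point of $\Delta_i$ that lies in $M$, such that the images $p_0^i,p_1^i,p_2^i,p_3^i$ of its four vertices are generic. The vertices of the $\Delta_i$ are ordered consistently with an orientation, i.e. all gluings reverse the induced orientations of the faces. Put $$[M]=\sum_{i=1}^k[p_0^i,p_1^i,p_2^i,p_3^i]\in C_3(S^3)_G/\operatorname{Im}(\bar d_4),\qquad \beta(M)=c([M])\in\mathcal P(\mathbb C).$$ **Theorem.** Let $M$ be a 3-dimensional spherical CR manifold with a CR triangulation (ideal if $M$ is not compact). Then the homomorphisms $c$ and $D$ above are well defined and $$D(\beta(M))=0 .$$ -/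

import Mathlib

open scoped LinearAlgebra.Projectivization Manifold Topology ComplexConjugate

noncomputable section

namespace SphericalCR

/-! ## The pre-Bloch group and the Bloch-Wigner function -/

/-- The free generators of the pre-Bloch group: `F \ {0, 1}`. -/
abbrev Gen (F : Type*) [Field F] : Type _ := {z : F // z ≠ 0 ∧ z ≠ 1}

/-- The 5-term relations `[x] - [y] + [y/x] - [(1-x⁻¹)/(1-y⁻¹)] + [(1-x)/(1-y)]`, for all
`x, y ∈ F \ {0, 1}` for which the five terms are defined (that is, for `x ≠ y`). -/
def fiveTermRelations (F : Type*) [Field F] : Set (FreeAbelianGroup (Gen F)) :=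
  {r | ∃ x y a b c : Gen F,
      (a : F) = y / x ∧
      (b : F) = (1 - (x : F)⁻¹) / (1 - (y : F)⁻¹) ∧
      (c : F) = (1 - x) / (1 - y) ∧
      r = FreeAbelianGroup.of x - FreeAbelianGroup.of y + FreeAbelianGroup.of a
        - FreeAbelianGroup.of b + FreeAbelianGroup.of c}

/-- The pre-Bloch group `𝒫(F)`. -/
abbrev PreBloch (F : Type*) [Field F] : Type _ :=
  FreeAbelianGroup (Gen F) ⧸ AddSubgroup.closure (fiveTermRelations F)

/-- The class `[z] ∈ 𝒫(F)` of `z ∈ F \ {0, 1}`. -/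
def PreBloch.of {F : Type*} [Field F] (z : Gen F) : PreBloch F :=
  QuotientAddGroup.mk (FreeAbelianGroup.of z)

/-- The Bloch-Wigner function `D(x) = arg(1-x) log|x| - Im ∫₀ˣ log(1-t) dt/t`. The integral is
taken along the straight segment `t = s x`, `0 ≤ s ≤ 1`, and `arg`, `log` are the principal
branches (for real `x > 1` the two terms cancel, so that `D` vanishes on the real axis). -/
def blochWigner (x : ℂ) : ℝ :=
  Complex.arg (1 - x) * Real.log ‖x‖ - (∫ s in (0 : ℝ)..1, Complex.log (1 - s * x) / s).im

/-! ## The sphere at infinity of the complex hyperbolic plane, and `PU(2,1)` -/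

/-- The space `ℂ³` (with the Hermitian form below it is `ℂ^{2,1}`). -/
abbrev C21 : Type := Fin 3 → ℂ

/-- The matrix of the Hermitian form. -/
def formJ : Matrix (Fin 3) (Fin 3) ℂ := !![0, 0, 1; 0, 1, 0; 1, 0, 0]

/-- The Hermitian form `⟨z, w⟩ = w^* J z` of signature `(2,1)`. -/
def herm (z w : C21) : ℂ := star w ⬝ᵥ formJ.mulVec z

/-- The Hermitian cross product `v ⊠ w`. It is orthogonal to `v` and to `w`. -/
def box (v w : C21) : C21 :=
  ![conj (v 0) * conj (w 1) - conj (v 1) * conj (w 0),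
    conj (v 2) * conj (w 0) - conj (v 0) * conj (w 2),
    conj (v 1) * conj (w 2) - conj (v 2) * conj (w 1)]

/-- The quotient topology on the complex projective plane. -/
instance : TopologicalSpace (ℙ ℂ C21) :=
  inferInstanceAs (TopologicalSpace (Quotient (projectivizationSetoid ℂ C21)))

/-- The standard CR sphere `S³`: the complex null lines of `ℂ^{2,1}`. -/
abbrev S3 : Type := {p : ℙ ℂ C21 // herm p.rep p.rep = 0}

/-- A lift of a point of `S³` to `ℂ^{2,1}`. -/
def S3.lift (p : S3) : C21 := p.1.rep

/-- The unitary group `U(2,1)` of the Hermitian form. -/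
def U21 : Subgroup (C21 ≃ₗ[ℂ] C21) where
  carrier := {A | ∀ v w, herm (A v) (A w) = herm v w}
  one_mem' _ _ := rfl
  mul_mem' {A B} hA hB v w := by
    change herm (A (B v)) (A (B w)) = _
    rw [hA, hB]
  inv_mem' {A} hA v w := by
    have h := hA (A⁻¹ v) (A⁻¹ w)
    have e : ∀ u, A (A⁻¹ u) = u := fun u => LinearEquiv.apply_symm_apply A u
    rw [e, e] at h
    exact h.symm

theorem herm_eq (z w : C21) :
    herm z w = z 0 * conj (w 2) + z 1 * conj (w 1) + z 2 * conj (w 0) := by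
  simp [herm, formJ, Matrix.mulVec, dotProduct, Fin.sum_univ_three]
  ring

theorem herm_smul_left (a : ℂ) (z w : C21) : herm (a • z) w = a * herm z w := by
  simp [herm_eq]; ring

theorem herm_smul_right (a : ℂ) (z w : C21) : herm z (a • w) = conj a * herm z w := by
  simp [herm_eq]; ring

theorem herm_add_left (x y w : C21) : herm (x + y) w = herm x w + herm y w := by
  simp [herm_eq]; ring

theorem null_rep_mk {v : C21} (hv : v ≠ 0) :
    herm (Projectivization.mk ℂ v hv).rep (Projectivization.mk ℂ v hv).rep = 0 ↔
      herm v v = 0 := by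
  obtain ⟨a, ha⟩ := Projectivization.exists_smul_eq_mk_rep ℂ v hv
  rw [← ha, Units.smul_def, herm_smul_left, herm_smul_right]
  simp

theorem smul_null (A : U21) (p : ℙ ℂ C21) (hp : herm p.rep p.rep = 0) :
    herm (A • p).rep (A • p).rep = 0 := by
  have e : A • p = Projectivization.mk ℂ ((A : C21 ≃ₗ[ℂ] C21) p.rep)
      (by simpa using p.rep_nonzero) := by
    conv_lhs => rw [← p.mk_rep]
    rfl
  rw [e, null_rep_mk, A.2]
  exact hp

/-- The action of `U(2,1)` on `S³`. -/
instance : MulAction U21 S3 where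
  smul A p := ⟨A • p.1, smul_null A p.1 p.2⟩
  one_smul p := Subtype.ext (one_smul U21 p.1)
  mul_smul A B p := Subtype.ext (mul_smul A B p.1)

/-- The group `PU(2,1)`, as a group of transformations of `S³`: the image of `U(2,1)`, that is,
`U(2,1)` modulo scalars. -/
def PU21 : Subgroup (Equiv.Perm S3) := (MulAction.toPermHom U21 S3).range

/-! ## Spherical CR manifolds -/

/-- The pseudogroup of homeomorphisms between open subsets of `S³` which agree locally with
elements of `PU(2,1)`. A spherical CR manifold is a space `M` with `ChartedSpace S3 M` and
`HasGroupoid M crGroupoid`. -/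
def crGroupoid : StructureGroupoid S3 where
  members := {e | ∀ x ∈ e.source, ∃ g : PU21, ∀ᶠ y in 𝓝 x, e y = g • y}
  trans' e e' he he' x hx := by
    rw [OpenPartialHomeomorph.trans_source] at hx
    obtain ⟨g, hg⟩ := he x hx.1
    obtain ⟨g', hg'⟩ := he' (e x) hx.2
    refine ⟨g' * g, ?_⟩
    filter_upwards [hg, (e.continuousAt hx.1).eventually hg'] with y h1 h2
    rw [OpenPartialHomeomorph.coe_trans, Function.comp_apply, h2, h1, mul_smul]
  symm' e he x hx := by
    obtain ⟨g, hg⟩ := he (e.symm x) (e.map_target hx)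
    refine ⟨g⁻¹, ?_⟩
    filter_upwards [(e.symm.continuousAt hx).eventually hg, e.open_target.mem_nhds hx]
      with y h1 h2
    rw [e.right_inv h2] at h1
    rw [eq_inv_smul_iff, ← h1]
  id_mem' x _ := ⟨1, by simp⟩
  locality' e h x hx := by
    obtain ⟨s, hs, hxs, he⟩ := h x hx
    exact he x (by rw [e.restr_source' s hs]; exact ⟨hx, hxs⟩)
  mem_of_eqOnSource' e e' he h x hx := by
    have hx' : x ∈ e.source := h.1 ▸ hx
    obtain ⟨g, hg⟩ := he x hx'
    refine ⟨g, ?_⟩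
    filter_upwards [hg, e'.open_source.mem_nhds hx] with y h1 h2
    rw [h.2 h2, h1]

/-! ## Generic configurations of points -/

/-- A `ℂ`-circle: the boundary of a complex line of the complex hyperbolic plane, that is, the set
of null lines contained in a complex plane `W ⊆ ℂ^{2,1}` that contains a negative vector. -/
def IsCCircle (C : Set S3) : Prop :=
  ∃ W : Submodule ℂ C21, Module.finrank ℂ W = 2 ∧ (∃ w ∈ W, (herm w w).re < 0) ∧
    C = {p : S3 | p.1.submodule ≤ W}

/-- Points of `S³` are generic if they are distinct and no three of them lie on a `ℂ`-circle. -/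
def Generic {n : ℕ} (p : Fin n → S3) : Prop :=
  Function.Injective p ∧
    ∀ i j k : Fin n, i ≠ j → i ≠ k → j ≠ k →
      ¬ ∃ C : Set S3, IsCCircle C ∧ p i ∈ C ∧ p j ∈ C ∧ p k ∈ C

/-- Generic ordered `n`-tuples of points of `S³`. -/
abbrev GenericTuple (n : ℕ) : Type := {p : Fin n → S3 // Generic p}

theorem Generic.comp {m n : ℕ} {p : Fin n → S3} (hp : Generic p) {f : Fin m → Fin n}
    (hf : Function.Injective f) : Generic (p ∘ f) :=
  ⟨hp.1.comp hf, fun i j k hij hik hjk =>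
    hp.2 (f i) (f j) (f k) (hf.ne hij) (hf.ne hik) (hf.ne hjk)⟩

theorem submodule_smul (A : U21) (p : S3) :
    (A • p).1.submodule = p.1.submodule.map ((A : C21 ≃ₗ[ℂ] C21) : C21 →ₗ[ℂ] C21) := by
  have e : (A • p).1 = Projectivization.mk ℂ ((A : C21 ≃ₗ[ℂ] C21) p.1.rep)
      (by simpa using p.1.rep_nonzero) := by
    change A • p.1 = _
    conv_lhs => rw [← p.1.mk_rep]
    rfl
  rw [e, Projectivization.submodule_mk, Projectivization.submodule_eq, Submodule.map_span]
  simp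

theorem IsCCircle.preimage_smul (A : U21) {C : Set S3} (hC : IsCCircle C) :
    IsCCircle {p | A • p ∈ C} := by
  obtain ⟨W, hW, ⟨w, hw, hneg⟩, rfl⟩ := hC
  refine ⟨W.comap ((A : C21 ≃ₗ[ℂ] C21) : C21 →ₗ[ℂ] C21), ?_,
    ⟨(A : C21 ≃ₗ[ℂ] C21).symm w, ?_, ?_⟩, ?_⟩
  · have e := Submodule.map_equiv_eq_comap_symm (A : C21 ≃ₗ[ℂ] C21).symm W
    rw [LinearEquiv.symm_symm] at e
    rw [← hW, ← e]
    exact LinearEquiv.finrank_map_eq _ _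
  · simpa using hw
  · rw [← A.2, LinearEquiv.apply_symm_apply]
    exact hneg
  · ext p
    simp only [Set.mem_ofPred_eq, submodule_smul, Submodule.map_le_iff_le_comap]

theorem Generic.smul {n : ℕ} {p : Fin n → S3} (hp : Generic p) (g : PU21) :
    Generic (fun i => g • p i) := by
  obtain ⟨g, A, rfl⟩ := g
  refine ⟨fun i j h => hp.1 (smul_left_cancel _ h), fun i j k hij hik hjk => ?_⟩
  rintro ⟨C, hC, h1, h2, h3⟩
  exact hp.2 i j k hij hik hjk ⟨_, hC.preimage_smul A, h1, h2, h3⟩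

/-! ## The cross-ratios of a configuration and the element `β` -/

/-- The invariant `[a,b,c,d] = ⟨d, a ⊠ b⟩ ⟨c, a⟩ / (⟨c, a ⊠ b⟩ ⟨d, a⟩)` of four points of `S³`.
It does not depend on the chosen lifts. -/
def crossRatio (a b c d : S3) : ℂ :=
  (herm d.lift (box a.lift b.lift) * herm c.lift a.lift) /
    (herm c.lift (box a.lift b.lift) * herm d.lift a.lift)

theorem herm_box_left (a b : C21) : herm a (box a b) = 0 := by
  simp [herm_eq, box]; ring

theorem herm_box_right (a b : C21) : herm b (box a b) = 0 := by
  simp [herm_eq, box]; ring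

theorem lift_ne_zero (p : S3) : p.lift ≠ 0 := p.1.rep_nonzero

theorem herm_lift_self (p : S3) : herm p.lift p.lift = 0 := p.2

theorem herm_conj (v w : C21) : conj (herm v w) = herm w v := by
  simp [herm_eq]; ring

theorem herm_ne_zero {p q : S3} (h : p ≠ q) : herm p.lift q.lift ≠ 0 := by
  intro h0
  apply h
  set v := p.lift with hv
  set w := q.lift with hw
  have h0' : herm w v = 0 := by rw [← herm_conj, h0, map_zero]
  have hvv : herm v v = 0 := herm_lift_self p
  have hww : herm w w = 0 := herm_lift_self q
  -- a null vector whose outer coordinates agree is zero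
  have key : ∀ u : C21, herm u u = 0 → u 0 = u 2 → u = 0 := by
    intro u hu he
    rw [herm_eq, ← he, Complex.mul_conj, Complex.mul_conj] at hu
    have hu' : Complex.normSq (u 0) + Complex.normSq (u 1) + Complex.normSq (u 0) = 0 := by
      exact_mod_cast hu
    have n0 := Complex.normSq_nonneg (u 0)
    have n1 := Complex.normSq_nonneg (u 1)
    have z0 : u 0 = 0 := Complex.normSq_eq_zero.1 (by linarith)
    have z1 : u 1 = 0 := Complex.normSq_eq_zero.1 (by linarith)
    ext i
    fin_cases i
    · exact z0
    · exact z1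
    · exact he ▸ z0
  have hdep : (w 0 - w 2) • v + (-(v 0 - v 2)) • w = 0 := by
    apply key
    · have expand : ∀ a b : ℂ, herm (a • v + b • w) (a • v + b • w) =
          a * conj a * herm v v + a * conj b * herm v w + b * conj a * herm w v
            + b * conj b * herm w w := by
        intro a b
        simp [herm_eq]; ring
      rw [expand, hvv, h0, h0', hww]
      ring
    · simp; ring
  have hb : v 0 - v 2 ≠ 0 := fun hb =>
    lift_ne_zero p (key v hvv (sub_eq_zero.1 hb))
  have ha : w 0 - w 2 ≠ 0 := fun ha =>
    lift_ne_zero q (key w hww (sub_eq_zero.1 ha))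
  apply Subtype.ext
  rw [← p.1.mk_rep, ← q.1.mk_rep, Projectivization.mk_eq_mk_iff']
  refine ⟨(w 0 - w 2)⁻¹ * (v 0 - v 2), ?_⟩
  change _ • w = v
  have : (w 0 - w 2) • v = (v 0 - v 2) • w := by
    have := hdep
    rw [neg_smul, ← sub_eq_add_neg, sub_eq_zero] at this
    exact this
  rw [mul_smul, ← this, smul_smul, inv_mul_cancel₀ ha, one_smul]

theorem linearIndependent_lift {a b : S3} (h : a ≠ b) :
    LinearIndependent ℂ ![a.lift, b.lift] :=
  Projectivization.linearIndependent_pair_iff_ne.2 fun e => h (Subtype.ext e)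

theorem mem_span_of_herm_box {a b : S3} (h : a ≠ b) {x : C21}
    (hx : herm x (box a.lift b.lift) = 0) :
    x ∈ Submodule.span ℂ (Set.range ![a.lift, b.lift]) := by
  by_contra hmem
  have hli : LinearIndependent ℂ (![x, a.lift, b.lift]) :=
    linearIndependent_finCons.2 ⟨linearIndependent_lift h, hmem⟩
  have hu : IsUnit (Matrix.of ![x, a.lift, b.lift]) :=
    Matrix.linearIndependent_rows_iff_isUnit.1 hli
  rw [Matrix.isUnit_iff_isUnit_det, Matrix.det_fin_three] at hu
  apply hu.ne_zero
  rw [herm_eq] at hx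
  simp [box] at hx ⊢
  linear_combination hx

theorem herm_box_ne_zero {n : ℕ} {p : Fin n → S3} (hp : Generic p) {i j k : Fin n}
    (hij : i ≠ j) (hik : i ≠ k) (hjk : j ≠ k) :
    herm (p k).lift (box (p i).lift (p j).lift) ≠ 0 := by
  intro h0
  have hne : p i ≠ p j := hp.1.ne hij
  have hmem := mem_span_of_herm_box hne h0
  set W := Submodule.span ℂ (Set.range ![(p i).lift, (p j).lift]) with hW
  have hi : (p i).lift ∈ W := Submodule.subset_span ⟨0, rfl⟩
  have hj : (p j).lift ∈ W := Submodule.subset_span ⟨1, rfl⟩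
  have hle : ∀ q : S3, q.lift ∈ W → q.1.submodule ≤ W := by
    intro q hq
    rw [Projectivization.submodule_eq, Submodule.span_singleton_le_iff_mem]
    exact hq
  refine hp.2 i j k hij hik hjk ⟨{q : S3 | q.1.submodule ≤ W}, ⟨W, ?_, ?_, rfl⟩,
    hle _ hi, hle _ hj, hle _ hmem⟩
  · simpa using finrank_span_eq_card (linearIndependent_lift hne)
  · refine ⟨(p i).lift + (-herm (p i).lift (p j).lift) • (p j).lift,
      W.add_mem hi (W.smul_mem _ hj), ?_⟩
    set v := (p i).lift
    set w := (p j).lift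
    have expand : ∀ b : ℂ, herm (v + b • w) (v + b • w) =
        herm v v + conj b * herm v w + b * herm w v + b * conj b * herm w w := by
      intro b
      simp [herm_eq]; ring
    have hvv : herm v v = 0 := herm_lift_self _
    have hww : herm w w = 0 := herm_lift_self _
    rw [expand, hvv, hww, ← herm_conj v w]
    have hpos : 0 < Complex.normSq (herm v w) := Complex.normSq_pos.2 (herm_ne_zero hne)
    rw [Complex.normSq_apply] at hpos
    simp
    linarith

theorem crossRatio_mem {p : Fin 4 → S3} (hp : Generic p) {i j k l : Fin 4}
    (hij : i ≠ j) (hik : i ≠ k) (hil : i ≠ l) (hjk : j ≠ k) (hjl : j ≠ l) (hkl : k ≠ l) :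
    crossRatio (p i) (p j) (p k) (p l) ≠ 0 ∧ crossRatio (p i) (p j) (p k) (p l) ≠ 1 := by
  have d1 := herm_box_ne_zero hp hij hil hjl
  have d2 := herm_box_ne_zero hp hij hik hjk
  have h1 := herm_ne_zero (hp.1.ne hik.symm)
  have h2 := herm_ne_zero (hp.1.ne hil.symm)
  have h3 := herm_ne_zero (hp.1.ne hij.symm)
  have d3 := herm_box_ne_zero hp hik.symm hkl hil
  refine ⟨div_ne_zero (mul_ne_zero d1 h1) (mul_ne_zero d2 h2), fun h => ?_⟩
  rw [crossRatio, div_eq_one_iff_eq (mul_ne_zero d2 h2)] at h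
  set a := (p i).lift
  set b := (p j).lift
  set c := (p k).lift
  set d := (p l).lift
  have haa : herm a a = 0 := herm_lift_self _
  have hx : herm (herm c a • d + (-herm d a) • c) (box a b) = 0 := by
    rw [herm_add_left, herm_smul_left, herm_smul_left]
    linear_combination h
  have hmem := mem_span_of_herm_box (hp.1.ne hij) hx
  rw [Matrix.range_cons, Matrix.range_cons, Matrix.range_empty, Set.union_empty,
    Set.singleton_union, Submodule.mem_span_pair] at hmem
  obtain ⟨s, t, hst⟩ := hmem
  have e1 := congrArg (fun u => herm u a) hst
  simp only [herm_add_left, herm_smul_left] at e1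
  have e2 : t = 0 := by
    have : t * herm b a = 0 := by
      linear_combination e1 - s * haa
    exact (mul_eq_zero.1 this).resolve_right h3
  have e3 := congrArg (fun u => herm u (box c a)) hst
  simp only [herm_add_left, herm_smul_left, herm_box_left, e2] at e3
  have e4 : herm (p i).lift (box c a) = 0 := herm_box_right c a
  have : herm c a * herm d (box c a) = 0 := by linear_combination -e3 + s * e4
  exact mul_ne_zero h1 d3 this

/-- The invariant `z_{ij} = [p_i, p_j, p_k, p_l]` of a generic configuration, as an element of
`ℂ \ {0, 1}`. -/
def zInv (p : GenericTuple 4) (i j k l : Fin 4)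
    (h : i ≠ j ∧ i ≠ k ∧ i ≠ l ∧ j ≠ k ∧ j ≠ l ∧ k ≠ l := by decide) : Gen ℂ :=
  ⟨crossRatio (p.1 i) (p.1 j) (p.1 k) (p.1 l),
    crossRatio_mem p.2 h.1 h.2.1 h.2.2.1 h.2.2.2.1 h.2.2.2.2.1 h.2.2.2.2.2⟩

/-- `β(p₀,p₁,p₂,p₃) = [z₀₁] + [z₁₀] + [z₂₃] + [z₃₂] ∈ 𝒫(ℂ)`. -/
def beta (p : GenericTuple 4) : PreBloch ℂ :=
  PreBloch.of (zInv p 0 1 2 3) + PreBloch.of (zInv p 1 0 3 2) +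
    PreBloch.of (zInv p 2 3 0 1) + PreBloch.of (zInv p 3 2 1 0)

/-! ## The complex of generic configurations and its co-invariants -/

/-- `C_n(S³)`: the free abelian group on the generic ordered `(n+1)`-tuples of points of `S³`. -/
abbrev Chain (n : ℕ) : Type := FreeAbelianGroup (GenericTuple (n + 1))

/-- The differential `d : C_{n+1}(S³) → C_n(S³)`, the alternating sum of the faces. -/
def d (n : ℕ) : Chain (n + 1) →+ Chain n :=
  FreeAbelianGroup.lift fun p => ∑ i : Fin (n + 2),
    (-1 : ℤ) ^ (i : ℕ) •
      FreeAbelianGroup.of ⟨p.1 ∘ i.succAbove, p.2.comp Fin.succAbove_right_injective⟩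

/-- The diagonal action of `g ∈ PU(2,1)` on `C_n(S³)`. -/
def act (n : ℕ) (g : PU21) : Chain n →+ Chain n :=
  FreeAbelianGroup.map fun p => ⟨fun i => g • p.1 i, p.2.smul g⟩

/-- The subgroup of `C_n(S³)` generated by the elements `g m - m`. -/
def coinvKer (n : ℕ) : AddSubgroup (Chain n) :=
  AddSubgroup.closure {r | ∃ (g : PU21) (m : Chain n), r = act n g m - m}

/-- The group of co-invariants `C_n(S³)_G`, `G = PU(2,1)`. -/
abbrev Coinv (n : ℕ) : Type := Chain n ⧸ coinvKer n

theorem d_act (n : ℕ) (g : PU21) (m : Chain (n + 1)) :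
    d n (act (n + 1) g m) = act n g (d n m) := by
  have : (d n).comp (act (n + 1) g) = (act n g).comp (d n) := by
    ext p
    simp only [AddMonoidHom.comp_apply, act, d, FreeAbelianGroup.map_of_apply,
      FreeAbelianGroup.lift_apply_of, map_sum, map_zsmul]
    rfl
  exact DFunLike.congr_fun this m

theorem coinvKer_le (n : ℕ) : coinvKer (n + 1) ≤ (coinvKer n).comap (d n) := by
  rw [coinvKer, AddSubgroup.closure_le]
  rintro _ ⟨g, m, rfl⟩
  refine AddSubgroup.subset_closure ⟨g, d n m, ?_⟩
  rw [map_sub, d_act]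

/-- The induced differential `C_{n+1}(S³)_G → C_n(S³)_G`. -/
def dBar (n : ℕ) : Coinv (n + 1) →+ Coinv n :=
  QuotientAddGroup.map (coinvKer (n + 1)) (coinvKer n) (d n) (coinvKer_le n)

/-- The group `C_3(S³)_G / Im(d̄_4)`. -/
abbrev ConfigQuotient : Type := Coinv 3 ⧸ (dBar 3).range

/-- The class `[p₀,p₁,p₂,p₃] ∈ C_3(S³)_G / Im(d̄_4)` of a generic configuration. -/
def configClass (p : GenericTuple 4) : ConfigQuotient :=
  QuotientAddGroup.mk (QuotientAddGroup.mk (FreeAbelianGroup.of p) : Coinv 3)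

/-! ## CR triangulations -/

/-- Combinatorial data gluing `k` tetrahedra, each with ordered vertices `0, 1, 2, 3`, along their
faces. The face `(i, f)` is the face of the `i`-th tetrahedron opposite to its vertex `f`. The
faces are glued in pairs; a face may be glued to another face of the same tetrahedron. -/
structure Gluing (k : ℕ) where
  /-- The face to which a face is glued. -/
  pair : Fin k × Fin 4 → Fin k × Fin 4
  pair_pair : ∀ F, pair (pair F) = F
  pair_ne : ∀ F, pair F ≠ F
  /-- The vertex `v ≠ F.2` of the face `F` is glued to the vertex `perm F v` of the face `pair F`;
  this bijection of vertices is extended by sending the opposite vertex to the opposite vertex. -/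
  perm : Fin k × Fin 4 → Equiv.Perm (Fin 4)
  perm_opposite : ∀ F, perm F F.2 = (pair F).2
  perm_pair : ∀ F, perm (pair F) = (perm F)⁻¹
  /-- The orders of the vertices are consistent with an orientation of the glued space: the
  gluings reverse the orientations induced on the faces. -/
  perm_sign : ∀ F, Equiv.Perm.sign (perm F) = -1

/-- The part of the standard 3-simplex that is present in a manifold `M`: the whole simplex if `M`
is compact, and the simplex without its (ideal) vertices if `M` is not compact. -/
def simplexIn (M : Type*) [TopologicalSpace M] : Set (Fin 4 → ℝ) :=
  {x ∈ stdSimplex ℝ (Fin 4) | CompactSpace M ∨ ∀ v, x ≠ Pi.single v 1}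

/-- The elementary identifications: a point `a` on a face of a tetrahedron (the points with
barycentric coordinate `0` at the opposite vertex) is identified with the point `b` of the paired
face, by the affine map given by the bijection of vertices. -/
def Gluing.Rel {k : ℕ} (G : Gluing k) (M : Type*) [TopologicalSpace M]
    (a b : Fin k × simplexIn M) : Prop :=
  ∃ f : Fin 4, a.2.1 f = 0 ∧ b.1 = (G.pair (a.1, f)).1 ∧
    ∀ v, b.2.1 (G.perm (a.1, f) v) = a.2.1 v

/-- The glued space (without the vertices if `M` is not compact), with the quotient topology. -/
abbrev Gluing.Realization {k : ℕ} (G : Gluing k) (M : Type*) [TopologicalSpace M] : Type :=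
  Quot (G.Rel M)

/-- A CR triangulation of a spherical CR manifold `M` by finitely many CR tetrahedra
`Δ_1, …, Δ_k`; it is an ideal triangulation if `M` is not compact. Each `Δ_i` is developed into
`S³` by the charts of `M`, and its four (possibly ideal) vertices develop to a generic
configuration of points of `S³`. -/
structure CRTriangulation (M : Type*) [TopologicalSpace M] [ChartedSpace S3 M] where
  /-- The number of tetrahedra. -/
  k : ℕ
  /-- The combinatorics of the triangulation. -/
  gluing : Gluing k
  /-- The triangulation itself. -/
  homeo : gluing.Realization M ≃ₜ M
  /-- The development of the closed `i`-th tetrahedron into `S³`. -/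
  dev : Fin k → (Fin 4 → ℝ) → S3
  dev_continuous : ∀ i, ContinuousOn (dev i) (stdSimplex ℝ (Fin 4))
  /-- Near each point of the tetrahedron in `M`, the development is given by a chart of the
  spherical CR structure. -/
  dev_chart : ∀ (i : Fin k) (x : simplexIn M),
    ∃ e ∈ crGroupoid.maximalAtlas M, homeo (Quot.mk _ (i, x)) ∈ e.source ∧
      ∀ᶠ y : simplexIn M in 𝓝 x, dev i y = e (homeo (Quot.mk _ (i, y)))
  /-- The vertices of each tetrahedron form a generic configuration. -/
  generic : ∀ i, Generic fun v : Fin 4 => dev i (Pi.single v 1)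

/-- The ordered vertices `(p₀ⁱ, p₁ⁱ, p₂ⁱ, p₃ⁱ)` of the `i`-th CR tetrahedron. -/
def CRTriangulation.vertices {M : Type*} [TopologicalSpace M] [ChartedSpace S3 M]
    (T : CRTriangulation M) (i : Fin T.k) : GenericTuple 4 :=
  ⟨fun v => T.dev i (Pi.single v 1), T.generic i⟩

/-- The class `[M] = ∑ᵢ [p₀ⁱ, p₁ⁱ, p₂ⁱ, p₃ⁱ] ∈ C_3(S³)_G / Im(d̄_4)`. -/
def CRTriangulation.fundamentalClass {M : Type*} [TopologicalSpace M] [ChartedSpace S3 M]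
    (T : CRTriangulation M) : ConfigQuotient :=
  ∑ i, configClass (T.vertices i)

end SphericalCR

end

open SphericalCR

noncomputable section

namespace SphericalCR

/-! ## The Bloch-Wigner function: derivative and symmetries -/

section BlochWigner

open Complex Set MeasureTheory intervalIntegral

/-! The volume of a configuration is a sum of contributions of its faces, and faces glued together
contribute opposite amounts. For null vectors put H(u,v,w) = ⟨u,v⟩⟨v,w⟩⟨w,u⟩. Twice `D` of the four
cross-ratios of a tetrahedron is the alternating sum over its faces of `D(-H/H̄)`
(`two_mul_volume`). This face term is invariant under PU(2,1) and changes sign under odd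
permutations of the vertices. A gluing reverses orientation and is realized on vertices by one
element of PU(2,1), so the involution pairing the faces negates the total, which therefore vanishes.

The face formula uses only the five-term relation and `D(z̄) = -D(z)`. With a = z₀₁, b = z₁₀ and c,
d the conjugates of z₂₃, z₃₂, one has ab = cd, and (1-a)/(1-d), (1-b)/(1-c) are complex conjugates.
Hence D(a)+D(b)-D(c)-D(d) collapses to D(s)-D(t) (`blochWigner_four_term`). The five-term relation
for (z, z̄) writes 2D(s) and 2D(t) through values on the unit circle. One of these values is common
to s and t; the other four are the face terms.

Well-definedness of `D`: its differential involves no branch of the argument, so the five-term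
expression has zero derivative in x. It is then constant on a connected set and is evaluated at real
points, where `D` vanishes.

Well-definedness of `c`: in 𝒫(ℂ) one has [1/z] = [1-z] = -[z], so the class of a cross-ratio
alternates in its last three arguments. For five points, the twenty terms of the boundary are
grouped by first argument. Each group reduces, by a five-term relation at that vertex
(`crossClass_vertex`), to a cross-ratio of four lines through a point of the plane. These five
classes satisfy one more five-term relation (`blochClass_plane`).

Gluing: an element of PU(2,1) is determined by its action on an open set (`eq_one_of_fixes_open`),
so the element relating two developments at a point of a common face is unique and locally constant.
The face is connected even without its vertices, and continuity carries the relation to the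
vertices. -/

theorem one_sub_mul_mem_slitPlane {z : ℂ} (hz : 1 - z ∈ slitPlane) {s : ℝ} (h0 : 0 ≤ s)
    (h1 : s ≤ 1) : 1 - s * z ∈ slitPlane := by
  have h : 1 + (-z) ∈ slitPlane := by rwa [← sub_eq_add_neg]
  have := StarConvex.add_smul_mem starConvex_one_slitPlane h h0 h1
  simpa [sub_eq_add_neg] using this

/-- The singularity at 0 is removable: away from 0 the integrand is the slope of s ↦ log(1 - sz) at
0, which extends continuously to `dslope`. -/
theorem intervalIntegrable_log_one_sub_div {z : ℂ} {b : ℝ} (hb : 0 ≤ b)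
    (h : ∀ s : ℝ, s ∈ Icc 0 b → 1 - s * z ∈ slitPlane) :
    IntervalIntegrable (fun s : ℝ => log (1 - s * z) / s) volume 0 b := by
  set f : ℝ → ℂ := fun s => log (1 - s * z) with hf
  set U : Set ℝ := {s : ℝ | 1 - s * z ∈ slitPlane} with hU
  have hUo : IsOpen U := isOpen_slitPlane.preimage (by fun_prop)
  have hd : ∀ s ∈ U, DifferentiableAt ℝ f s := by
    intro s hs
    have h1 : HasDerivAt (fun s : ℝ => (1 - s * z : ℂ)) (-z) s := by
      simpa using ((Complex.ofRealCLM.hasDerivAt (x := s)).mul_const z).const_sub 1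
    exact (h1.clog_real hs).differentiableAt
  have h0 : (0 : ℝ) ∈ U := by simp [hU]
  have hc : ContinuousOn (dslope f 0) U :=
    (continuousOn_dslope (hUo.mem_nhds h0)).2
      ⟨fun s hs => (hd s hs).continuousAt.continuousWithinAt, hd 0 h0⟩
  have hi : IntervalIntegrable (dslope f 0) volume 0 b :=
    (hc.mono (by rw [uIcc_of_le hb]; exact h)).intervalIntegrable
  refine hi.congr fun s hs => ?_
  rw [uIoc_of_le hb] at hs
  rw [dslope_of_ne _ hs.1.ne', slope_def_module]
  simp [hf, div_eq_inv_mul]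

/-- The integral in the definition of the Bloch-Wigner function, as a holomorphic function. -/
def logIntegral (z : ℂ) : ℂ := ∫ s in (0 : ℝ)..1, log (1 - s * z) / s

/-- Differentiation under the integral sign turns the integrand into -1/(1 - sz), whose primitive in
s is log(1 - sz)/z. Domination comes from compactness of [0,1] times a closed ball around z. -/
theorem hasDerivAt_logIntegral {z : ℂ} (hz : 1 - z ∈ slitPlane) (hz0 : z ≠ 0) :
    HasDerivAt logIntegral (log (1 - z) / z) z := by
  have hUo : IsOpen {w : ℂ | 1 - w ∈ slitPlane} := isOpen_slitPlane.preimage (by fun_prop)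
  obtain ⟨ε, hε, hball⟩ := Metric.nhds_basis_closedBall.mem_iff.1 (hUo.mem_nhds hz)
  have hslit : ∀ p ∈ Icc (0 : ℝ) 1 ×ˢ Metric.closedBall z ε, (1 - (p.1 : ℂ) * p.2) ∈ slitPlane :=
    fun p hp => one_sub_mul_mem_slitPlane (hball hp.2) hp.1.1 hp.1.2
  obtain ⟨C, hC⟩ := (isCompact_Icc.prod (isCompact_closedBall z ε)).exists_bound_of_continuousOn
    (f := fun p : ℝ × ℂ => -(1 - (p.1 : ℂ) * p.2)⁻¹)
    (ContinuousOn.neg (ContinuousOn.inv₀ (by fun_prop) fun p hp => slitPlane_ne_zero (hslit p hp)))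
  have hcont : ∀ w ∈ Metric.closedBall z ε,
      ContinuousOn (fun s : ℝ => -(1 - (s : ℂ) * w)⁻¹) (Icc 0 1) := fun w hw =>
    ContinuousOn.neg (ContinuousOn.inv₀ (by fun_prop)
      fun s hs => slitPlane_ne_zero (hslit (s, w) ⟨hs, hw⟩))
  have hzmem : z ∈ Metric.closedBall z ε := Metric.mem_closedBall_self hε.le
  have hint : ∀ w ∈ Metric.closedBall z ε,
      IntervalIntegrable (fun s : ℝ => log (1 - s * w) / s) volume 0 1 := fun w hw =>
    intervalIntegrable_log_one_sub_div zero_le_one fun s hs => hslit (s, w) ⟨hs, hw⟩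
  have key := (hasDerivAt_integral_of_dominated_loc_of_deriv_le (μ := volume) (a := 0) (b := 1)
    (F := fun w (s : ℝ) => log (1 - s * w) / s) (F' := fun w (s : ℝ) => -(1 - (s : ℂ) * w)⁻¹)
    (x₀ := z) (s := Metric.closedBall z ε) (bound := fun _ => C)
    (Metric.closedBall_mem_nhds z hε) ?_ (hint z hzmem) ?_ ?_ intervalIntegrable_const ?_).2
  · convert! key using 1
    have hF : ∀ s ∈ uIcc (0 : ℝ) 1,
        HasDerivAt (fun s : ℝ => log (1 - s * z) / z) (-(1 - (s : ℂ) * z)⁻¹) s := by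
      intro s hs
      rw [uIcc_of_le zero_le_one] at hs
      have h1 : HasDerivAt (fun s : ℝ => (1 - s * z : ℂ)) (-z) s := by
        simpa using ((Complex.ofRealCLM.hasDerivAt (x := s)).mul_const z).const_sub 1
      have h2 := (h1.clog_real (hslit (s, z) ⟨hs, hzmem⟩)).div_const z
      convert! h2 using 1
      have := slitPlane_ne_zero (hslit (s, z) ⟨hs, hzmem⟩)
      field_simp
    rw [integral_eq_sub_of_hasDerivAt hF]
    · simp
    · refine ContinuousOn.intervalIntegrable ?_
      rw [uIcc_of_le zero_le_one]
      exact hcont z hzmem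
  · filter_upwards [Metric.closedBall_mem_nhds z hε] with w hw
    have := (hint w hw).aestronglyMeasurable
    rwa [uIoc_of_le zero_le_one]
  · rw [uIoc_of_le zero_le_one]
    exact ((hcont z hzmem).mono Ioc_subset_Icc_self).aestronglyMeasurable measurableSet_Ioc
  · filter_upwards with s hs w hw
    rw [uIoc_of_le zero_le_one] at hs
    exact hC (s, w) ⟨Ioc_subset_Icc_self hs, hw⟩
  · filter_upwards with s hs w hw
    rw [uIoc_of_le zero_le_one] at hs
    have hs0 : (s : ℂ) ≠ 0 := by exact_mod_cast hs.1.ne'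
    have h1 : HasDerivAt (fun w : ℂ => (1 - s * w : ℂ)) (-s) w := by
      simpa using ((hasDerivAt_id w).const_mul (s : ℂ)).const_sub 1
    have h2 := (h1.clog (hslit (s, w) ⟨Ioc_subset_Icc_self hs, hw⟩)).div_const (s : ℂ)
    convert! h2 using 1
    have := slitPlane_ne_zero (hslit (s, w) ⟨Ioc_subset_Icc_self hs, hw⟩)
    field_simp

/-! ### The differential of `D` off the cut -/

theorem blochWigner_eq (z : ℂ) :
    blochWigner z = (log (1 - z)).im * Real.log ‖z‖ - (logIntegral z).im := by
  rw [log_im]; rfl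

/-- The Bloch-Wigner function has differential `h ↦ Im (h * blochWignerDeriv z)` at `z`. -/
def blochWignerDeriv (z : ℂ) : ℂ :=
  -(Real.log ‖z‖ : ℂ) / (1 - z) - (Real.log ‖1 - z‖ : ℂ) / z

/-- The real-linear functional `h ↦ Im (h * a)`. -/
def imMul (a : ℂ) : ℂ →L[ℝ] ℝ := imCLM.comp ((ContinuousLinearMap.mul ℝ ℂ).flip a)

@[simp]
theorem imMul_apply (a h : ℂ) : imMul a h = (h * a).im := rfl

theorem hasFDerivAt_im_of_hasDerivAt {f : ℂ → ℂ} {f' z : ℂ} (h : HasDerivAt f f' z) :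
    HasFDerivAt (fun w => (f w).im) (imMul f') z := by
  have := imCLM.hasFDerivAt.comp z (h.hasFDerivAt.restrictScalars ℝ)
  refine this.congr_fderiv ?_
  ext1 h
  simp [mul_comm]

/-- For |a| = 1, log|w| is the imaginary part of i log(aw); the choice a = 1 or a = -1 keeps az off
the branch cut. -/
theorem hasFDerivAt_log_norm {z : ℂ} (hz : z ≠ 0) :
    HasFDerivAt (fun w : ℂ => Real.log ‖w‖) (imMul (I / z)) z := by
  have main : ∀ a : ℂ, ‖a‖ = 1 → a * z ∈ slitPlane →
      HasFDerivAt (fun w : ℂ => Real.log ‖w‖) (imMul (I / z)) z := by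
    intro a ha hs
    have h1 : HasDerivAt (fun w : ℂ => I * log (a * w)) (I / z) z := by
      have := ((((hasDerivAt_id z).const_mul a)).clog hs).const_mul I
      convert! this using 1
      have : a ≠ 0 := by rintro rfl; simp at ha
      simp only [id]
      field_simp
    refine (hasFDerivAt_im_of_hasDerivAt h1).congr_of_eventuallyEq ?_
    filter_upwards with w
    simp [log_re, ha]
  by_cases hs : z ∈ slitPlane
  · exact main 1 (by simp) (by simpa using hs)
  · refine main (-1) (by simp) ?_
    rw [mem_slitPlane_iff] at hs ⊢
    push Not at hs
    left
    have : z.re ≠ 0 := fun h => hz (Complex.ext h hs.2)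
    simp
    exact lt_of_le_of_ne hs.1 this

theorem hasFDerivAt_blochWigner_of_mem_slitPlane {z : ℂ} (hz : 1 - z ∈ slitPlane) (hz0 : z ≠ 0) :
    HasFDerivAt blochWigner (imMul (blochWignerDeriv z)) z := by
  have h1 : HasDerivAt (fun w : ℂ => log (1 - w)) (-1 / (1 - z)) z :=
    ((hasDerivAt_id z).const_sub 1).clog hz
  have h2 := ((hasFDerivAt_im_of_hasDerivAt h1).mul (hasFDerivAt_log_norm hz0)).sub
    (hasFDerivAt_im_of_hasDerivAt (hasDerivAt_logIntegral hz hz0))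
  have h3 : blochWigner = fun w => (log (1 - w)).im * Real.log ‖w‖ - (logIntegral w).im :=
    funext blochWigner_eq
  rw [h3]
  refine h2.congr_fderiv ?_
  ext1 h
  have e : (log (1 - z) : ℂ) = Real.log ‖1 - z‖ + (log (1 - z)).im * I := by
    rw [← log_re, re_add_im]
  -- Here t = arg(1 - z). The product rule and the derivative of the integral each produce t times d
  -- log|z|, with opposite signs, so no argument survives in the differential.
  generalize (log (1 - z)).im = t at *
  have hh : h * (log (1 - z) / z) = Real.log ‖1 - z‖ * (h / z) + t * (I * (h / z)) := by
    rw [e]; ring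
  have hd : h * blochWignerDeriv z =
      Real.log ‖z‖ * (h * (-1 / (1 - z))) - Real.log ‖1 - z‖ * (h / z) := by
    rw [blochWignerDeriv]; ring
  have hi : h * (I / z) = I * (h / z) := by ring
  simp only [sub_apply, add_apply,
    smul_apply, imMul_apply, hh, hd, hi, smul_eq_mul, add_im, sub_im,
    im_ofReal_mul]
  ring

/-! ### Complex conjugation and values on the real axis -/

theorem blochWigner_conj_of_mem_slitPlane {z : ℂ} (hz : 1 - z ∈ slitPlane) :
    blochWigner (conj z) = -blochWigner z := by
  have h1 : ∀ s : ℝ, s ∈ Icc (0 : ℝ) 1 → log (1 - s * conj z) = conj (log (1 - s * z)) := by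
    intro s hs
    rw [← log_conj _ (slitPlane_arg_ne_pi (one_sub_mul_mem_slitPlane hz hs.1 hs.2))]
    simp
  have h2 : logIntegral (conj z) = conj (logIntegral z) := by
    rw [logIntegral, logIntegral, ← intervalIntegral_conj]
    refine integral_congr fun s hs => ?_
    rw [uIcc_of_le zero_le_one] at hs
    simp [h1 s hs]
  have h3 := h1 1 (by simp)
  simp only [ofReal_one, one_mul] at h3
  rw [blochWigner_eq, blochWigner_eq, h2, h3, norm_conj, conj_im, conj_im]
  ring

theorem arg_one_sub_ofReal_of_one_lt {x : ℝ} (hx : 1 < x) : arg (1 - x) = Real.pi := by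
  rw [← ofReal_one, ← ofReal_sub, arg_ofReal_of_neg (by linarith)]

theorem arg_one_sub_ofReal_of_le_one {x : ℝ} (hx : x ≤ 1) : arg (1 - x) = 0 := by
  rw [← ofReal_one, ← ofReal_sub, arg_ofReal_of_nonneg (by linarith)]

theorem intervalIntegrable_log_one_sub_ofReal_div {x : ℝ} (hx : 1 < x) :
    IntervalIntegrable (fun s : ℝ => log (1 - s * x) / s) volume 0 1 := by
  have hx0 : 0 < x := by linarith
  -- The point 1/(2x) separates the removable singularity at 0 from the logarithmic one at 1/x: up
  -- to it, 1 - sx ≥ 1/2, and beyond it 1/s is continuous.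
  have hb : 0 < (2 * x)⁻¹ := by positivity
  have h1 : IntervalIntegrable (fun s : ℝ => log (1 - s * x) / s) volume 0 (2 * x)⁻¹ := by
    refine intervalIntegrable_log_one_sub_div hb.le fun s hs => ?_
    rw [mem_slitPlane_iff]
    left
    have : s * x ≤ (2 * x)⁻¹ * x := mul_le_mul_of_nonneg_right hs.2 hx0.le
    have e : (2 * x)⁻¹ * x = 1 / 2 := by field_simp
    simp
    linarith
  have hb1 : (2 * x)⁻¹ ≤ 1 := inv_le_one_of_one_le₀ (by linarith)
  have hlog : IntervalIntegrable (fun s : ℝ => log (1 - s * x)) volume (2 * x)⁻¹ 1 := by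
    have hre : IntervalIntegrable (fun s : ℝ => Real.log (1 - x * s)) volume (2 * x)⁻¹ 1 := by
      have h := (intervalIntegrable_log' (a := 1 - x * (2 * x)⁻¹) (b := 1 - x * 1)).comp_sub_left 1
      have h' := h.comp_mul_left (c := x)
      rwa [sub_sub_cancel, sub_sub_cancel, mul_div_cancel_left₀ _ hx0.ne', mul_div_cancel_left₀ _ hx0.ne'] at h'
    have him : IntervalIntegrable (fun s : ℝ => arg (1 - s * x)) volume (2 * x)⁻¹ 1 := by
      rw [intervalIntegrable_iff]
      refine Measure.integrableOn_of_bounded (M := Real.pi) (by simp) ?_ ?_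
      · exact (measurable_arg.comp (by fun_prop)).aestronglyMeasurable
      · filter_upwards with s
        simpa using abs_arg_le_pi _
    have hre' : IntervalIntegrable (fun s : ℝ => (Real.log (1 - x * s) : ℂ)) volume (2 * x)⁻¹ 1 :=
      ⟨hre.1.ofReal, hre.2.ofReal⟩
    have him' : IntervalIntegrable (fun s : ℝ => (arg (1 - s * x) : ℂ)) volume (2 * x)⁻¹ 1 :=
      ⟨him.1.ofReal, him.2.ofReal⟩
    refine (hre'.add (him'.mul_const I)).congr fun s _ => ?_
    rw [log, ← ofReal_one, ← ofReal_mul, ← ofReal_sub, norm_real, Real.norm_eq_abs, Real.log_abs,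
      mul_comm x s]
  refine h1.trans ?_
  have h2 : ContinuousOn (fun s : ℝ => ((s : ℂ)⁻¹)) (uIcc (2 * x)⁻¹ 1) := by
    refine ContinuousOn.inv₀ (by fun_prop) fun s hs => ?_
    rw [uIcc_of_le hb1] at hs
    exact_mod_cast (hb.trans_le hs.1).ne'
  simpa only [div_eq_mul_inv] using hlog.mul_continuousOn h2

/-- The Bloch-Wigner function vanishes on the real axis. -/
theorem blochWigner_ofReal (x : ℝ) : blochWigner x = 0 := by
  rcases le_or_gt x 1 with hx | hx
  · have h : logIntegral x = ((∫ s in (0 : ℝ)..1, Real.log (1 - s * x) / s : ℝ) : ℂ) := by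
      rw [logIntegral, ← intervalIntegral.integral_ofReal]
      refine integral_congr fun s hs => ?_
      rw [uIcc_of_le zero_le_one] at hs
      have h1 : 0 ≤ 1 - s * x := by
        rcases le_or_gt x 0 with h | h
        · nlinarith [mul_nonneg hs.1 (neg_nonneg.2 h)]
        · nlinarith [mul_le_mul hs.2 hx h.le zero_le_one]
      push_cast [ofReal_log h1]
      rfl
    rw [blochWigner_eq, log_im, arg_one_sub_ofReal_of_le_one hx, h, ofReal_im]
    simp
  · have hx0 : 0 < x := by linarith
    have hint := intervalIntegrable_log_one_sub_ofReal_div hx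
    have h : (logIntegral x).im = ∫ s in (0 : ℝ)..1, arg (1 - s * x) / s := by
      have := imCLM.intervalIntegral_comp_comm hint
      rw [logIntegral, ← imCLM_apply, ← this]
      refine integral_congr fun s _ => ?_
      simp only [imCLM_apply, div_ofReal_im, log_im]
    have hre : IntervalIntegrable (fun s : ℝ => arg (1 - s * x) / s) volume 0 1 := by
      have h1 := ContinuousLinearMap.integrable_comp imCLM (intervalIntegrable_iff.1 hint)
      rw [intervalIntegrable_iff]
      refine h1.congr ?_
      filter_upwards with s
      simp only [imCLM_apply, div_ofReal_im, log_im]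
    have hi0 : (0 : ℝ) < x⁻¹ := by positivity
    have hi1 : x⁻¹ ≤ 1 := inv_le_one_of_one_le₀ hx.le
    have hsub1 : IntervalIntegrable (fun s : ℝ => arg (1 - s * x) / s) volume 0 x⁻¹ :=
      hre.mono_set (by rw [uIcc_of_le hi0.le, uIcc_of_le zero_le_one]; exact Icc_subset_Icc_right hi1)
    have hsub2 : IntervalIntegrable (fun s : ℝ => arg (1 - s * x) / s) volume x⁻¹ 1 :=
      hre.mono_set (by rw [uIcc_of_le hi1, uIcc_of_le zero_le_one]; exact Icc_subset_Icc_left hi0.le)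
    have e1 : ∫ s in (0 : ℝ)..x⁻¹, arg (1 - s * x) / s = 0 := by
      rw [integral_congr (g := fun _ => (0 : ℝ))]
      · simp
      · intro s hs
        rw [uIcc_of_le hi0.le] at hs
        have : s * x ≤ 1 := by
          have := mul_le_mul_of_nonneg_right hs.2 hx0.le
          rwa [inv_mul_cancel₀ hx0.ne'] at this
        simp only
        rw [← ofReal_mul, arg_one_sub_ofReal_of_le_one this, zero_div]
    -- Beyond s = 1/x the path runs along the cut, where the principal argument is π. The resulting
    -- π log x cancels the first term of `D`.
    have e2 : ∫ s in x⁻¹..1, arg (1 - s * x) / s = Real.pi * Real.log x := by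
      rw [intervalIntegral.integral_congr_ae (g := fun s : ℝ => Real.pi * s⁻¹)]
      · rw [intervalIntegral.integral_const_mul, integral_inv_of_pos hi0 one_pos]
        simp
      · filter_upwards with s hs
        rw [uIoc_of_le hi1] at hs
        have : 1 < s * x := by
          have := mul_lt_mul_of_pos_right hs.1 hx0
          rwa [inv_mul_cancel₀ hx0.ne'] at this
        rw [← ofReal_mul, arg_one_sub_ofReal_of_one_lt this, div_eq_mul_inv]
    rw [blochWigner_eq, log_im, arg_one_sub_ofReal_of_one_lt hx, h,
      ← integral_add_adjacent_intervals hsub1 hsub2, e1, e2, norm_real, Real.norm_eq_abs,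
      abs_of_pos hx0]
    ring

theorem one_sub_mem_slitPlane_of_im_ne_zero {z : ℂ} (hz : z.im ≠ 0) : 1 - z ∈ slitPlane := by
  rw [mem_slitPlane_iff]
  right
  simpa using hz

theorem blochWigner_conj (z : ℂ) : blochWigner (conj z) = -blochWigner z := by
  by_cases hz : z.im = 0
  · have : z = (z.re : ℂ) := Complex.ext rfl (by simpa using hz)
    rw [this, conj_ofReal, blochWigner_ofReal, neg_zero]
  · exact blochWigner_conj_of_mem_slitPlane (one_sub_mem_slitPlane_of_im_ne_zero hz)

/-- The chain rule for the Bloch-Wigner function composed with a holomorphic function. -/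
theorem HasFDerivAt.blochWigner_comp {u : ℂ → ℂ} {u' z : ℂ}
    (hD : HasFDerivAt blochWigner (imMul (blochWignerDeriv (u z))) (u z)) (hu : HasDerivAt u u' z) :
    HasFDerivAt (fun w => blochWigner (u w)) (imMul (blochWignerDeriv (u z) * u')) z := by
  have := hD.comp z (hu.hasFDerivAt.restrictScalars ℝ)
  refine this.congr_fderiv ?_
  ext1 h
  simp
  ring_nf

/-! ### Inversion, and the differential across the cut -/

theorem blochWignerDeriv_inv {z : ℂ} (h0 : z ≠ 0) (h1 : z ≠ 1) :
    blochWignerDeriv z⁻¹ * (-(z ^ 2)⁻¹) = -blochWignerDeriv z := by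
  have h1' : 1 - z ≠ 0 := sub_ne_zero.2 h1.symm
  have h2' : z - 1 ≠ 0 := sub_ne_zero.2 h1
  have e : 1 - z⁻¹ = -(1 - z) / z := by field_simp; ring
  have h1n : ‖1 - z‖ ≠ 0 := norm_ne_zero_iff.2 h1'
  have h0n : ‖z‖ ≠ 0 := norm_ne_zero_iff.2 h0
  rw [blochWignerDeriv, blochWignerDeriv, e, norm_div, norm_neg, norm_inv, Real.log_div h1n h0n,
    Real.log_inv]
  push_cast
  field_simp
  ring

/-- The inversion relation on the upper half plane. -/
theorem blochWigner_inv_of_im_pos {z : ℂ} (hz : 0 < z.im) : blochWigner z⁻¹ = -blochWigner z := by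
  have hs : Convex ℝ {w : ℂ | 0 < w.im} := convex_halfSpace_im_gt 0
  have hd : ∀ w ∈ {w : ℂ | 0 < w.im},
      HasFDerivAt (fun w => blochWigner w⁻¹ + blochWigner w) (0 : ℂ →L[ℝ] ℝ) w := by
    intro w hw
    have hw : 0 < w.im := hw
    have h0 : w ≠ 0 := by rintro rfl; simp at hw
    have h1 : w ≠ 1 := by rintro rfl; simp at hw
    have him : (w⁻¹).im ≠ 0 := by
      rw [inv_im]
      exact div_ne_zero (neg_ne_zero.2 hw.ne') (normSq_pos.2 h0).ne'
    have e1 := HasFDerivAt.blochWigner_comp (hasFDerivAt_blochWigner_of_mem_slitPlane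
      (one_sub_mem_slitPlane_of_im_ne_zero him) (inv_ne_zero h0)) (hasDerivAt_inv h0)
    have e2 := hasFDerivAt_blochWigner_of_mem_slitPlane
      (one_sub_mem_slitPlane_of_im_ne_zero hw.ne') h0
    refine (e1.add e2).congr_fderiv ?_
    rw [blochWignerDeriv_inv h0 h1]
    ext1 h
    simp
  have hc := hs.is_const_of_fderivWithin_eq_zero (𝕜 := ℝ)
    (f := fun w => blochWigner w⁻¹ + blochWigner w)
    (fun w hw => (hd w hw).differentiableAt.differentiableWithinAt)
    (fun w hw => by
      rw [fderivWithin_of_isOpen (isOpen_lt continuous_const continuous_im) hw, (hd w hw).fderiv])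
    hz (show (0 : ℝ) < I.im by simp)
  -- The constant is found at i, where inversion coincides with conjugation.
  have hI : blochWigner I⁻¹ + blochWigner I = 0 := by
    rw [inv_I, ← conj_I, blochWigner_conj]; ring
  simp only [hI] at hc
  linarith

theorem blochWigner_inv (z : ℂ) : blochWigner z⁻¹ = -blochWigner z := by
  rcases lt_trichotomy z.im 0 with hz | hz | hz
  · have h := blochWigner_inv_of_im_pos (z := conj z) (by simpa using hz)
    rw [← map_inv₀, blochWigner_conj, blochWigner_conj] at h
    linarith
  · have : z = (z.re : ℂ) := Complex.ext rfl (by simpa using hz)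
    rw [this, ← ofReal_inv, blochWigner_ofReal, blochWigner_ofReal, neg_zero]
  · exact blochWigner_inv_of_im_pos hz

/-- If z lies on the cut, then z is real and greater than 1, so 1/z is off the cut and D(z) =
-D(1/z) carries the differential over. -/
theorem hasFDerivAt_blochWigner {z : ℂ} (h0 : z ≠ 0) (h1 : z ≠ 1) :
    HasFDerivAt blochWigner (imMul (blochWignerDeriv z)) z := by
  by_cases hz : 1 - z ∈ slitPlane
  · exact hasFDerivAt_blochWigner_of_mem_slitPlane hz h0
  · have hz' : 1 - z⁻¹ ∈ slitPlane := by
      rw [mem_slitPlane_iff] at hz ⊢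
      push Not at hz
      have him : z.im = 0 := by simpa using hz.2
      have hre : 1 ≤ z.re := by simpa using hz.1
      have e : z = (z.re : ℂ) := Complex.ext rfl (by simpa using him)
      left
      have hlt : 1 < z.re := lt_of_le_of_ne hre fun h => h1 (by rw [e, ← h]; simp)
      rw [e, ← ofReal_inv]
      simpa using inv_lt_one_of_one_lt₀ hlt
    have h2 := (HasFDerivAt.blochWigner_comp (hasFDerivAt_blochWigner_of_mem_slitPlane hz'
      (inv_ne_zero h0)) (hasDerivAt_inv h0)).neg
    refine (h2.congr_of_eventuallyEq ?_).congr_fderiv ?_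
    · filter_upwards with w
      simp [blochWigner_inv]
    · rw [blochWignerDeriv_inv h0 h1]
      ext1 h
      simp

end BlochWigner

/-! ## The five-term relation for the Bloch-Wigner function -/

section FiveTerm

open Complex Set

@[simp]
theorem blochWigner_zero : blochWigner 0 = 0 := by
  simpa using blochWigner_ofReal 0

@[simp]
theorem blochWigner_one : blochWigner 1 = 0 := by
  simpa using blochWigner_ofReal 1

/-- The five-term expression in the values of the Bloch-Wigner function. -/
def fiveTermSum (x y : ℂ) : ℝ :=
  blochWigner x - blochWigner y + blochWigner (y / x)
    - blochWigner ((1 - x⁻¹) / (1 - y⁻¹)) + blochWigner ((1 - x) / (1 - y))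

theorem fiveTermSum_swap (x y : ℂ) : fiveTermSum y x = -fiveTermSum x y := by
  have e1 : blochWigner (x / y) = -blochWigner (y / x) := by rw [← blochWigner_inv, inv_div]
  have e2 : blochWigner ((1 - y⁻¹) / (1 - x⁻¹)) = -blochWigner ((1 - x⁻¹) / (1 - y⁻¹)) := by
    rw [← blochWigner_inv, inv_div]
  have e3 : blochWigner ((1 - y) / (1 - x)) = -blochWigner ((1 - x) / (1 - y)) := by
    rw [← blochWigner_inv, inv_div]
  rw [fiveTermSum, fiveTermSum, e1, e2, e3]
  ring

theorem fiveTermSum_ofReal (x y : ℝ) : fiveTermSum x y = 0 := by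
  have h := blochWigner_ofReal
  have h3 := h (y / x)
  have h4 := h ((1 - x⁻¹) / (1 - y⁻¹))
  have h5 := h ((1 - x) / (1 - y))
  push_cast at h3 h4 h5
  rw [fiveTermSum, h, h, h3, h4, h5]
  simp

/-- All five arguments and their complements to 1 are, up to sign, products of powers of x, y, 1-x,
1-y and x-y. The differential is thus a combination of the logarithms of five absolute values, and
each coefficient is a rational function that vanishes identically. -/
theorem hasFDerivAt_fiveTermSum {x y : ℂ} (hx0 : x ≠ 0) (hx1 : x ≠ 1) (hy0 : y ≠ 0) (hy1 : y ≠ 1)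
    (hxy : x ≠ y) : HasFDerivAt (fun x => fiveTermSum x y) (0 : ℂ →L[ℝ] ℝ) x := by
  have hx : 1 - x ≠ 0 := sub_ne_zero.2 hx1.symm
  have hy : 1 - y ≠ 0 := sub_ne_zero.2 hy1.symm
  have hxy' : x - y ≠ 0 := sub_ne_zero.2 hxy
  have ex : 1 - x⁻¹ = -(1 - x) / x := by field_simp; ring
  have ey : 1 - y⁻¹ = -(1 - y) / y := by field_simp; ring
  have hw : (1 - x⁻¹) / (1 - y⁻¹) = ((1 - x) * y) / (x * (1 - y)) := by
    rw [ex, ey]; field_simp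
  have d3 : HasDerivAt (fun x => y / x) (-y / x ^ 2) x := by
    convert! (hasDerivAt_inv hx0).const_mul y using 1
    field_simp
  have d4 : HasDerivAt (fun x : ℂ => (1 - x⁻¹) / (1 - y⁻¹)) ((x ^ 2)⁻¹ / (1 - y⁻¹)) x := by
    simpa using ((hasDerivAt_inv hx0).const_sub 1).div_const (1 - y⁻¹)
  have d5 : HasDerivAt (fun x : ℂ => (1 - x) / (1 - y)) (-1 / (1 - y)) x := by
    simpa using ((hasDerivAt_id x).const_sub 1).div_const (1 - y)
  have s3 : 1 - y / x = (x - y) / x := by field_simp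
  have s4 : 1 - (1 - x⁻¹) / (1 - y⁻¹) = (x - y) / (x * (1 - y)) := by
    rw [hw]; field_simp; ring
  have s5 : 1 - (1 - x) / (1 - y) = (x - y) / (1 - y) := by field_simp; ring
  have n4 : (1 - x⁻¹) / (1 - y⁻¹) ≠ 0 := by rw [hw]; positivity
  have ne1 : ∀ w : ℂ, 1 - w ≠ 0 → w ≠ 1 := fun w h e => h (by rw [e, sub_self])
  have f3 := HasFDerivAt.blochWigner_comp (u := fun x => y / x) (hasFDerivAt_blochWigner (div_ne_zero hy0 hx0)
    (ne1 _ (by rw [s3]; exact div_ne_zero hxy' hx0))) d3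
  have f4 := HasFDerivAt.blochWigner_comp (u := fun x => (1 - x⁻¹) / (1 - y⁻¹)) (hasFDerivAt_blochWigner n4
    (ne1 _ (by rw [s4]; exact div_ne_zero hxy' (mul_ne_zero hx0 hy)))) d4
  have f5 := HasFDerivAt.blochWigner_comp (u := fun x => (1 - x) / (1 - y)) (hasFDerivAt_blochWigner (div_ne_zero hx hy)
    (ne1 _ (by rw [s5]; exact div_ne_zero hxy' hy))) d5
  have key := ((((hasFDerivAt_blochWigner hx0 hx1).sub_const (blochWigner y)).add f3).sub f4).add f5
  refine key.congr_fderiv ?_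
  have hsum : blochWignerDeriv x + blochWignerDeriv (y / x) * (-y / x ^ 2)
      - blochWignerDeriv ((1 - x⁻¹) / (1 - y⁻¹)) * ((x ^ 2)⁻¹ / (1 - y⁻¹))
      + blochWignerDeriv ((1 - x) / (1 - y)) * (-1 / (1 - y)) = 0 := by
    simp only [blochWignerDeriv]
    rw [s3, s4, s5, hw, ey]
    simp only [norm_div, norm_mul]
    have a1 := norm_ne_zero_iff.2 hx0
    have a2 := norm_ne_zero_iff.2 hy0
    have a3 := norm_ne_zero_iff.2 hx
    have a4 := norm_ne_zero_iff.2 hy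
    have a5 := norm_ne_zero_iff.2 hxy'
    rw [Real.log_div a2 a1, Real.log_div a5 a1, Real.log_div (mul_ne_zero a3 a2) (mul_ne_zero a1 a4),
      Real.log_div a5 (mul_ne_zero a1 a4), Real.log_div a3 a4, Real.log_div a5 a4,
      Real.log_mul a3 a2, Real.log_mul a1 a4]
    push_cast
    generalize (Real.log ‖x‖ : ℂ) = l1
    generalize (Real.log ‖y‖ : ℂ) = l2
    generalize (Real.log ‖1 - x‖ : ℂ) = l3
    generalize (Real.log ‖1 - y‖ : ℂ) = l4
    generalize (Real.log ‖x - y‖ : ℂ) = l5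
    field_simp
    ring
  ext1 h
  simp only [sub_apply, add_apply, imMul_apply, zero_apply, ← add_im, ← sub_im]
  rw [← mul_add, ← mul_sub, ← mul_add, hsum]
  simp

/-- The plane minus the three points 0, 1, y is connected, and the derivative in x vanishes there.
-/
theorem fiveTermSum_left_eq {x x' y : ℂ} (hx0 : x ≠ 0) (hx1 : x ≠ 1) (hxy : x ≠ y) (hx0' : x' ≠ 0)
    (hx1' : x' ≠ 1) (hxy' : x' ≠ y) (hy0 : y ≠ 0) (hy1 : y ≠ 1) :
    fiveTermSum x y = fiveTermSum x' y := by
  set S : Set ℂ := {0, 1, y}ᶜ with hS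
  have hfin : ({0, 1, y} : Set ℂ).Finite := by simp
  have hconn : IsPreconnected S :=
    (hfin.countable.isPathConnected_compl_of_one_lt_rank (by simp)).isConnected.isPreconnected
  have hopen : IsOpen S := hfin.isClosed.isOpen_compl
  have hd : ∀ w ∈ S, HasFDerivAt (fun x => fiveTermSum x y) (0 : ℂ →L[ℝ] ℝ) w := by
    intro w hw
    simp only [hS, mem_compl_iff, mem_insert_iff, mem_singleton_iff, not_or] at hw
    exact hasFDerivAt_fiveTermSum hw.1 hw.2.1 hy0 hy1 hw.2.2
  refine hopen.is_const_of_fderiv_eq_zero (𝕜 := ℝ) hconn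
    (fun w hw => (hd w hw).differentiableAt.differentiableWithinAt)
    (fun w hw => (hd w hw).fderiv) ?_ ?_ <;> simp [*]

/-- Start from the real pair (3, 2) and move the first variable. Antisymmetry then lets the second
variable be moved in the same way. -/
theorem fiveTermSum_eq_zero_of_ne_one {x y : ℂ} (hx0 : x ≠ 0) (hx1 : x ≠ 1) (hy0 : y ≠ 0)
    (hy1 : y ≠ 1) (hxy : x ≠ y) : fiveTermSum x y = 0 := by
  have h32 : fiveTermSum 3 2 = 0 := by simpa using fiveTermSum_ofReal 3 2
  have h2 : ∀ w : ℂ, w ≠ 0 → w ≠ 1 → w ≠ 2 → fiveTermSum w 2 = 0 := by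
    intro w h0 h1 h2
    rw [← h32]
    exact fiveTermSum_left_eq h0 h1 h2 (by norm_num) (by norm_num) (by norm_num) (by norm_num)
      (by norm_num)
  by_cases hy2 : y = 2
  · rw [hy2] at hxy ⊢
    exact h2 x hx0 hx1 hxy
  · rw [fiveTermSum_left_eq (x' := 2) hx0 hx1 hxy (by norm_num) (by norm_num) (Ne.symm hy2) hy0 hy1,
      fiveTermSum_swap, h2 y hy0 hy1 hy2, neg_zero]

/-- The five-term relation for the Bloch-Wigner function, including its degenerate cases. -/
theorem fiveTermSum_eq_zero {x y : ℂ} (hx0 : x ≠ 0) (hy0 : y ≠ 0) : fiveTermSum x y = 0 := by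
  have hdiag : ∀ w : ℂ, w ≠ 0 → fiveTermSum w w = 0 := by
    intro w hw
    have := fiveTermSum_swap w w
    linarith
  -- With y = 1 the last two arguments are divisions by zero, with value 0, where `D` vanishes; D(w)
  -- + D(1/w) remains.
  have hone : ∀ w : ℂ, fiveTermSum w 1 = 0 := by
    intro w
    simp [fiveTermSum, blochWigner_inv]
  by_cases hxy : x = y
  · rw [hxy]; exact hdiag y hy0
  by_cases hy1 : y = 1
  · rw [hy1]; exact hone x
  by_cases hx1 : x = 1
  · rw [fiveTermSum_swap, hx1, hone, neg_zero]
  · exact fiveTermSum_eq_zero_of_ne_one hx0 hx1 hy0 hy1 hxy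

/-- The homomorphism `𝒫(ℂ) → ℝ` defined by the Bloch-Wigner function. -/
def blochWignerHom : PreBloch ℂ →+ ℝ :=
  QuotientAddGroup.lift _ (FreeAbelianGroup.lift fun z : Gen ℂ => blochWigner z) <| by
    rw [AddSubgroup.closure_le]
    rintro _ ⟨x, y, a, b, c, ha, hb, hc, rfl⟩
    have := fiveTermSum_eq_zero x.2.1 y.2.1
    simpa [AddMonoidHom.mem_ker, ha, hb, hc, fiveTermSum] using this

theorem blochWignerHom_of (z : Gen ℂ) : blochWignerHom (PreBloch.of z) = blochWigner z := by
  simp [blochWignerHom, PreBloch.of]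

end FiveTerm

/-! ## Symmetries in the pre-Bloch group of the complex numbers -/

open Classical in
/-- The class of a complex number in `𝒫(ℂ)`, extended by zero to `0` and `1`. -/
def blochClass (z : ℂ) : PreBloch ℂ := if h : z ≠ 0 ∧ z ≠ 1 then PreBloch.of ⟨z, h⟩ else 0

theorem blochClass_coe (z : Gen ℂ) : blochClass z = PreBloch.of z := dif_pos z.2

@[simp]
theorem blochClass_zero : blochClass 0 = 0 := dif_neg (by simp)

@[simp]
theorem blochClass_one : blochClass 1 = 0 := dif_neg (by simp)

theorem blochClass_fiveTerm {x y : ℂ} (hx0 : x ≠ 0) (hx1 : x ≠ 1) (hy0 : y ≠ 0) (hy1 : y ≠ 1)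
    (hxy : x ≠ y) :
    blochClass x - blochClass y + blochClass (y / x) - blochClass ((1 - x⁻¹) / (1 - y⁻¹))
      + blochClass ((1 - x) / (1 - y)) = 0 := by
  have hx : 1 - x ≠ 0 := sub_ne_zero.2 hx1.symm
  have hy : 1 - y ≠ 0 := sub_ne_zero.2 hy1.symm
  have hx' : 1 - x⁻¹ ≠ 0 := sub_ne_zero.2 (inv_ne_one.2 hx1).symm
  have hy' : 1 - y⁻¹ ≠ 0 := sub_ne_zero.2 (inv_ne_one.2 hy1).symm
  have h3 : y / x ≠ 1 := fun h => hxy ((div_eq_one_iff_eq hx0).1 h).symm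
  have h4 : (1 - x⁻¹) / (1 - y⁻¹) ≠ 1 := fun h =>
    hxy (inv_injective (sub_right_injective ((div_eq_one_iff_eq hy').1 h)))
  have h5 : (1 - x) / (1 - y) ≠ 1 := fun h =>
    hxy (sub_right_injective ((div_eq_one_iff_eq hy).1 h))
  have key : (QuotientAddGroup.mk _ : PreBloch ℂ) = 0 :=
    (QuotientAddGroup.eq_zero_iff (N := AddSubgroup.closure (fiveTermRelations ℂ)) _).2
      (AddSubgroup.subset_closure ⟨⟨x, hx0, hx1⟩, ⟨y, hy0, hy1⟩, ⟨y / x, div_ne_zero hy0 hx0, h3⟩,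
        ⟨_, div_ne_zero hx' hy', h4⟩, ⟨_, div_ne_zero hx hy, h5⟩, rfl, rfl, rfl, rfl⟩)
  rw [← key]
  simp only [QuotientAddGroup.mk_add, QuotientAddGroup.mk_sub]
  rw [blochClass, dif_pos ⟨hx0, hx1⟩, blochClass, dif_pos ⟨hy0, hy1⟩, blochClass,
    dif_pos ⟨div_ne_zero hy0 hx0, h3⟩, blochClass, dif_pos ⟨div_ne_zero hx' hy', h4⟩, blochClass,
    dif_pos ⟨div_ne_zero hx hy, h5⟩]
  rfl

/-- The element `[z] + [z⁻¹]` is multiplicative in `z`. -/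
theorem blochClass_add_inv_mul {t v : ℂ} (ht0 : t ≠ 0) (ht1 : t ≠ 1) (hv0 : v ≠ 0) (hv1 : v ≠ 1)
    (htv : t * v ≠ 1) :
    blochClass (t * v) + blochClass (t * v)⁻¹ =
      (blochClass t + blochClass t⁻¹) + (blochClass v + blochClass v⁻¹) := by
  have h1 : t * v - 1 ≠ 0 := sub_ne_zero.2 htv
  have h1' : v * t - 1 ≠ 0 := by rwa [mul_comm]
  have h2 : v - 1 ≠ 0 := sub_ne_zero.2 hv1
  have h3 : t - 1 ≠ 0 := sub_ne_zero.2 ht1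
  have h4 : 1 - t ≠ 0 := sub_ne_zero.2 ht1.symm
  -- These solve y/x = t and (1-x)/(1-y) = v; the fourth argument is then tv. Adding the relations
  -- for (x,y) and (y,x) cancels [x] and [y] and leaves each remaining class together with that of
  -- its inverse.
  set x := (v - 1) / (t * v - 1) with hx
  set y := t * (v - 1) / (t * v - 1) with hy
  have ex : 1 - x = v * (t - 1) / (t * v - 1) := by rw [hx]; field_simp; ring
  have ey : 1 - y = (t - 1) / (t * v - 1) := by rw [hy]; field_simp; ring
  have exy : x - y = (1 - t) * (v - 1) / (t * v - 1) := by rw [hx, hy]; field_simp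
  have hx0 : x ≠ 0 := div_ne_zero h2 h1
  have hy0 : y ≠ 0 := div_ne_zero (mul_ne_zero ht0 h2) h1
  have hx1 : x ≠ 1 := by
    intro h; rw [h, sub_self] at ex; exact div_ne_zero (mul_ne_zero hv0 h3) h1 ex.symm
  have hy1 : y ≠ 1 := by
    intro h; rw [h, sub_self] at ey; exact div_ne_zero h3 h1 ey.symm
  have hxy : x ≠ y := by
    intro h; rw [h, sub_self] at exy; exact div_ne_zero (mul_ne_zero h4 h2) h1 exy.symm
  have ex' : 1 - x⁻¹ = -(1 - x) / x := by field_simp; ring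
  have ey' : 1 - y⁻¹ = -(1 - y) / y := by field_simp; ring
  have e3 : y / x = t := by rw [hx, hy]; field_simp
  have e5 : (1 - x) / (1 - y) = v := by rw [ex, ey]; field_simp
  have e4 : (1 - x⁻¹) / (1 - y⁻¹) = t * v := by rw [ex', ey', ex, ey, hx, hy]; field_simp
  have f1 := blochClass_fiveTerm hx0 hx1 hy0 hy1 hxy
  have f2 := blochClass_fiveTerm hy0 hy1 hx0 hx1 hxy.symm
  rw [← inv_div y x, ← inv_div (1 - x⁻¹), ← inv_div (1 - x), e3, e4, e5] at f2
  rw [e3, e4, e5] at f1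
  have := congrArg₂ (· + ·) f1 f2
  simp only [add_zero] at this
  rw [← sub_eq_zero, ← neg_eq_zero, ← this]
  abel

/-- Put f(z) = [z] + [1/z]. For an auxiliary r, multiplicativity gives f(r) = f(q) + f(r/q) and
f(r/q) = f(r) + f(1/q), while f(1/q) = f(q). -/
theorem blochClass_add_inv_add_self {q : ℂ} (hq0 : q ≠ 0) (hq1 : q ≠ 1) :
    (blochClass q + blochClass q⁻¹) + (blochClass q + blochClass q⁻¹) = 0 := by
  obtain ⟨r, hr⟩ := Set.Finite.exists_notMem (Set.toFinite ({0, 1, q} : Set ℂ))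
  simp only [Set.mem_insert_iff, Set.mem_singleton_iff, not_or] at hr
  obtain ⟨hr0, hr1, hrq⟩ := hr
  have hd1 : r * q⁻¹ ≠ 1 := fun h => hrq ((mul_inv_eq_one₀ hq0).1 h)
  have e : q * (r * q⁻¹) = r := by field_simp
  have f1 := blochClass_add_inv_mul hq0 hq1 (mul_ne_zero hr0 (inv_ne_zero hq0)) hd1
    (by rwa [e])
  have f2 := blochClass_add_inv_mul hr0 hr1 (inv_ne_zero hq0) (inv_ne_one.2 hq1) hd1
  rw [e, f2, inv_inv] at f1
  have := sub_eq_zero.2 f1.symm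
  rw [← this]
  abel

/-- Every complex number is a square q², so [z] + [1/z] is twice [q] + [1/q], which is zero. -/
theorem blochClass_inv (z : ℂ) : blochClass z⁻¹ = -blochClass z := by
  by_cases h0 : z = 0
  · simp [h0]
  by_cases h1 : z = 1
  · simp [h1]
  obtain ⟨q, rfl⟩ : ∃ q : ℂ, q * q = z := by
    obtain ⟨q, hq⟩ := IsAlgClosed.exists_pow_nat_eq z (n := 2) (by norm_num)
    exact ⟨q, by rw [← hq]; ring⟩
  have hq0 : q ≠ 0 := fun h => h0 (by simp [h])
  have hq1 : q ≠ 1 := fun h => h1 (by simp [h])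
  have := blochClass_add_inv_mul hq0 hq1 hq0 hq1 h1
  rw [blochClass_add_inv_add_self hq0 hq1] at this
  rw [eq_neg_iff_add_eq_zero, add_comm]
  exact this

/-- The five-term relations for (x, y) and for (1-y, 1-x) have the same last three terms up to
order; subtract them. -/
theorem blochClass_add_one_sub_const {x y : ℂ} (hx0 : x ≠ 0) (hx1 : x ≠ 1) (hy0 : y ≠ 0)
    (hy1 : y ≠ 1) : blochClass x + blochClass (1 - x) = blochClass y + blochClass (1 - y) := by
  by_cases hxy : x = y
  · rw [hxy]
  have hx : 1 - x ≠ 0 := sub_ne_zero.2 (Ne.symm hx1)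
  have hy : 1 - y ≠ 0 := sub_ne_zero.2 (Ne.symm hy1)
  have f1 := blochClass_fiveTerm hx0 hx1 hy0 hy1 hxy
  have f2 := blochClass_fiveTerm hy (by simpa using hy0) hx (by simpa using hx0)
    fun h => hxy (sub_right_injective h).symm
  have ex : 1 - x⁻¹ = -(1 - x) / x := by field_simp; ring
  have ey : 1 - y⁻¹ = -(1 - y) / y := by field_simp; ring
  have ex' : 1 - (1 - x)⁻¹ = -x / (1 - x) := by field_simp; ring
  have ey' : 1 - (1 - y)⁻¹ = -y / (1 - y) := by field_simp; ring
  have e : (1 - (1 - y)⁻¹) / (1 - (1 - x)⁻¹) = (1 - x⁻¹) / (1 - y⁻¹) := by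
    rw [ex, ey, ex', ey']; field_simp
  rw [e, sub_sub_cancel, sub_sub_cancel] at f2
  rw [← sub_eq_zero]
  calc _ = (blochClass x - blochClass y + blochClass (y / x)
        - blochClass ((1 - x⁻¹) / (1 - y⁻¹)) + blochClass ((1 - x) / (1 - y)))
        - (blochClass (1 - y) - blochClass (1 - x) + blochClass ((1 - x) / (1 - y))
        - blochClass ((1 - x⁻¹) / (1 - y⁻¹)) + blochClass (y / x)) := by abel
    _ = 0 := by rw [f1, f2, sub_zero]

/-- The constant [z] + [1-z] is evaluated at a primitive sixth root of unity ω, for which 1 - ω =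
1/ω. -/
theorem blochClass_one_sub (z : ℂ) : blochClass (1 - z) = -blochClass z := by
  by_cases h0 : z = 0
  · simp [h0]
  by_cases h1 : z = 1
  · simp [h1]
  obtain ⟨ω, hω⟩ : ∃ ω : ℂ, ω * ω - ω + 1 = 0 := by
    obtain ⟨s, hs⟩ := IsAlgClosed.exists_pow_nat_eq (-3 : ℂ) (n := 2) (by norm_num)
    exact ⟨(1 + s) / 2, by linear_combination hs / 4⟩
  have hω0 : ω ≠ 0 := by rintro rfl; norm_num at hω
  have hω1 : ω ≠ 1 := by rintro rfl; norm_num at hω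
  have e : 1 - ω = ω⁻¹ := by
    field_simp
    linear_combination -hω
  have := blochClass_add_one_sub_const h0 h1 hω0 hω1
  rw [e, blochClass_inv, add_neg_cancel] at this
  rw [eq_neg_iff_add_eq_zero, add_comm]
  exact this

/-! ## Cross-ratios of vectors -/

/-- The determinant of three vectors. -/
def tri (u v w : C21) : ℂ := herm w (box u v)

theorem tri_eq (u v w : C21) :
    tri u v w = (u 0 * v 1 - u 1 * v 0) * w 2 + (u 2 * v 0 - u 0 * v 2) * w 1
      + (u 1 * v 2 - u 2 * v 1) * w 0 := by
  simp [tri, herm_eq, box]; ring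

theorem tri_swap_left (u v w : C21) : tri v u w = -tri u v w := by
  rw [tri_eq, tri_eq]; ring

theorem tri_swap_right (u v w : C21) : tri u w v = -tri u v w := by
  rw [tri_eq, tri_eq]; ring

theorem tri_rotate (u v w : C21) : tri v w u = tri u v w := by
  rw [tri_eq, tri_eq]; ring

/-- Cramer's rule, paired with a vector. -/
theorem tri_mul_herm (a b c d x : C21) :
    tri b c d * herm a x - tri a c d * herm b x + tri a b d * herm c x
      - tri a b c * herm d x = 0 := by
  simp only [tri_eq, herm_eq]; ring

/-- The Plücker relation. -/
theorem tri_mul_tri (a b c d e : C21) :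
    tri a b c * tri a d e - tri a b d * tri a c e + tri a b e * tri a c d = 0 := by
  simp only [tri_eq]; ring

/-- The cross-ratio of four vectors. -/
def vecCross (a b c d : C21) : ℂ := (tri a b d * herm c a) / (tri a b c * herm d a)

theorem crossRatio_eq (a b c d : S3) :
    crossRatio a b c d = vecCross a.lift b.lift c.lift d.lift := rfl

theorem vecCross_swap_right (a b c d : C21) : vecCross a b d c = (vecCross a b c d)⁻¹ := by
  rw [vecCross, vecCross, inv_div]

/-- Cramer's rule paired with a itself loses one of its four terms because a is null; what remains
is a three-term relation. -/
theorem one_sub_vecCross {a b c d : C21} (ha : herm a a = 0) (h1 : tri a b c ≠ 0)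
    (h2 : herm d a ≠ 0) :
    1 - vecCross a b c d = -(tri a c d * herm b a) / (tri a b c * herm d a) := by
  have := tri_mul_herm a b c d a
  rw [ha] at this
  rw [vecCross]
  field_simp
  linear_combination -this

theorem vecCross_swap_left {a b c d : C21} (ha : herm a a = 0) (h1 : tri a b c ≠ 0)
    (h2 : herm d a ≠ 0) : vecCross a c b d = 1 - vecCross a b c d := by
  rw [one_sub_vecCross ha h1 h2, vecCross, tri_swap_right a b c]
  field_simp

/-- The class in `𝒫(ℂ)` of the cross-ratio of four vectors. -/
def crossClass (a b c d : C21) : PreBloch ℂ := blochClass (vecCross a b c d)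

theorem crossClass_swap_right (a b c d : C21) : crossClass a b d c = -crossClass a b c d := by
  rw [crossClass, vecCross_swap_right, blochClass_inv]; rfl

theorem crossClass_swap_left {a b c d : C21} (ha : herm a a = 0) (h1 : tri a b c ≠ 0)
    (h2 : herm d a ≠ 0) : crossClass a c b d = -crossClass a b c d := by
  rw [crossClass, vecCross_swap_left ha h1 h2, blochClass_one_sub]; rfl

/-- The five-term relation of the pencil of lines through a vertex. -/
theorem crossClass_vertex {a b c d e : C21} (ha : herm a a = 0) (hb : herm b a ≠ 0)
    (hc : herm c a ≠ 0) (hd : herm d a ≠ 0) (he : herm e a ≠ 0) (habc : tri a b c ≠ 0)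
    (habd : tri a b d ≠ 0) (habe : tri a b e ≠ 0) (hacd : tri a c d ≠ 0) (hace : tri a c e ≠ 0)
    (hade : tri a d e ≠ 0) :
    crossClass a b c d - crossClass a b c e + crossClass a b d e - crossClass a c d e
      = blochClass ((tri a c d * tri a b e) / (tri a c e * tri a b d)) := by
  have hx0 : vecCross a b c d ≠ 0 := div_ne_zero (mul_ne_zero habd hc) (mul_ne_zero habc hd)
  have hy0 : vecCross a b c e ≠ 0 := div_ne_zero (mul_ne_zero habe hc) (mul_ne_zero habc he)
  have ex := one_sub_vecCross ha habc hd
  have ey := one_sub_vecCross ha habc he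
  have hx1 : vecCross a b c d ≠ 1 := by
    intro h
    rw [h, sub_self] at ex
    exact div_ne_zero (neg_ne_zero.2 (mul_ne_zero hacd hb)) (mul_ne_zero habc hd) ex.symm
  have hy1 : vecCross a b c e ≠ 1 := by
    intro h
    rw [h, sub_self] at ey
    exact div_ne_zero (neg_ne_zero.2 (mul_ne_zero hace hb)) (mul_ne_zero habc he) ey.symm
  have e3 : vecCross a b c e / vecCross a b c d = vecCross a b d e := by
    rw [vecCross, vecCross, vecCross]; field_simp
  have hxy : vecCross a b c d ≠ vecCross a b c e := by
    intro h
    rw [h, div_self hy0] at e3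
    have e := one_sub_vecCross ha habd he
    rw [← e3, sub_self] at e
    exact div_ne_zero (neg_ne_zero.2 (mul_ne_zero hade hb)) (mul_ne_zero habd he) e.symm
  have e5 : (1 - vecCross a b c d) / (1 - vecCross a b c e) = (vecCross a c d e)⁻¹ := by
    rw [ex, ey, vecCross, inv_div]; field_simp
  -- In this term the Hermitian products cancel: it is the cross-ratio of the four lines joining a
  -- to b, c, d, e and no longer involves the form.
  have e4 : (1 - (vecCross a b c d)⁻¹) / (1 - (vecCross a b c e)⁻¹) =
      (tri a c d * tri a b e) / (tri a c e * tri a b d) := by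
    have i1 : 1 - (vecCross a b c d)⁻¹ = -(1 - vecCross a b c d) / vecCross a b c d := by
      field_simp; ring
    have i2 : 1 - (vecCross a b c e)⁻¹ = -(1 - vecCross a b c e) / vecCross a b c e := by
      field_simp; ring
    rw [i1, i2, ex, ey, vecCross, vecCross]; field_simp
  have key := blochClass_fiveTerm hx0 hx1 hy0 hy1 hxy
  rw [e3, e4, e5, blochClass_inv] at key
  rw [← sub_eq_zero, ← key, crossClass, crossClass, crossClass, crossClass]
  abel

/-- The five-term relation of five points in the projective plane. -/
theorem blochClass_plane {a b c d e : C21} (habc : tri a b c ≠ 0) (habd : tri a b d ≠ 0)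
    (habe : tri a b e ≠ 0) (hacd : tri a c d ≠ 0) (hace : tri a c e ≠ 0) (hade : tri a d e ≠ 0)
    (hbcd : tri b c d ≠ 0) (hbce : tri b c e ≠ 0) (hbde : tri b d e ≠ 0) (hcde : tri c d e ≠ 0) :
    blochClass ((tri a c d * tri a b e) / (tri a c e * tri a b d))
      - blochClass ((tri b c d * tri b a e) / (tri b c e * tri b a d))
      + blochClass ((tri c b d * tri c a e) / (tri c b e * tri c a d))
      - blochClass ((tri d b c * tri d a e) / (tri d b e * tri d a c))
      + blochClass ((tri e b c * tri e a d) / (tri e b d * tri e a c)) = 0 := by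
  -- x and y are the cross-ratios of the pencils of lines through a and b. Plücker relations factor
  -- 1 - x, 1 - y and x - y, and the other three arguments become the cross-ratios at c, d, e.
  set x := (tri a c d * tri a b e) / (tri a c e * tri a b d) with hx
  set y := (tri b c d * tri b a e) / (tri b c e * tri b a d) with hy
  have hy' : y = (tri b c d * tri a b e) / (tri b c e * tri a b d) := by
    rw [hy, tri_swap_left a b e, tri_swap_left a b d]; field_simp
  have ex : 1 - x = (tri a b c * tri a d e) / (tri a c e * tri a b d) := by
    rw [hx]; field_simp
    linear_combination -(tri_mul_tri a b c d e)
  have ey : 1 - y = (tri a b c * tri b d e) / (tri b c e * tri a b d) := by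
    have h := tri_mul_tri b a c d e
    simp only [tri_swap_left a b] at h
    rw [hy']; field_simp
    linear_combination h
  have exy : x - y = (tri a b e * tri a b c * tri c d e) / (tri a c e * tri a b d * tri b c e) := by
    have h : tri a c d * tri b c e - tri b c d * tri a c e = tri a b c * tri c d e := by
      simp only [tri_eq]; ring
    rw [hx, hy']
    field_simp
    linear_combination h
  have hx0 : x ≠ 0 := div_ne_zero (mul_ne_zero hacd habe) (mul_ne_zero hace habd)
  have hy0 : y ≠ 0 := by
    rw [hy']; exact div_ne_zero (mul_ne_zero hbcd habe) (mul_ne_zero hbce habd)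
  have hx1 : x ≠ 1 := by
    intro h
    rw [h, sub_self] at ex
    exact div_ne_zero (mul_ne_zero habc hade) (mul_ne_zero hace habd) ex.symm
  have hy1 : y ≠ 1 := by
    intro h
    rw [h, sub_self] at ey
    exact div_ne_zero (mul_ne_zero habc hbde) (mul_ne_zero hbce habd) ey.symm
  have hxy : x ≠ y := by
    intro h
    rw [h, sub_self] at exy
    exact div_ne_zero (mul_ne_zero (mul_ne_zero habe habc) hcde)
      (mul_ne_zero (mul_ne_zero hace habd) hbce) exy.symm
  have e3 : y / x = (tri c b d * tri c a e) / (tri c b e * tri c a d) := by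
    rw [hx, hy', tri_swap_left b c d, tri_swap_left a c e, tri_swap_left b c e,
      tri_swap_left a c d]
    field_simp
  have e5 : (1 - x) / (1 - y) = (tri e b c * tri e a d) / (tri e b d * tri e a c) := by
    rw [ex, ey, ← tri_rotate e b c, ← tri_rotate e a d, ← tri_rotate e b d, ← tri_rotate e a c]
    field_simp
  have i1 : 1 - x⁻¹ = -(1 - x) / x := by field_simp; ring
  have i2 : 1 - y⁻¹ = -(1 - y) / y := by field_simp; ring
  have e4 : (1 - x⁻¹) / (1 - y⁻¹) = (tri d b c * tri d a e) / (tri d b e * tri d a c) := by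
    rw [i1, i2, ex, ey, hx, hy', ← tri_rotate d b c, tri_swap_left a d e, tri_swap_left b d e,
      ← tri_rotate d a c]
    field_simp
  have key := blochClass_fiveTerm hx0 hx1 hy0 hy1 hxy
  rw [e3, e4, e5] at key
  exact key

/-! ## The homomorphism `c` -/

theorem Generic.tri_ne_zero {n : ℕ} {p : Fin n → S3} (hp : Generic p) {i j k : Fin n}
    (hij : i ≠ j) (hik : i ≠ k) (hjk : j ≠ k) : tri (p i).lift (p j).lift (p k).lift ≠ 0 :=
  herm_box_ne_zero hp hij hik hjk

theorem Generic.herm_ne_zero {n : ℕ} {p : Fin n → S3} (hp : Generic p) {i j : Fin n}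
    (hij : i ≠ j) : herm (p i).lift (p j).lift ≠ 0 :=
  SphericalCR.herm_ne_zero (hp.1.ne hij)

theorem Generic.crossClass_swap_left {n : ℕ} {p : Fin n → S3} (hp : Generic p) {i j k l : Fin n}
    (hij : i ≠ j) (hik : i ≠ k) (hil : i ≠ l) (hjk : j ≠ k) :
    crossClass (p i).lift (p k).lift (p j).lift (p l).lift =
      -crossClass (p i).lift (p j).lift (p k).lift (p l).lift :=
  SphericalCR.crossClass_swap_left (herm_lift_self _) (hp.tri_ne_zero hij hik hjk)
    (hp.herm_ne_zero hil.symm)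

/-- Antisymmetry in the last three arguments puts them in increasing order; in this form the terms
of different faces can be compared. -/
theorem beta_eq (p : GenericTuple 4) :
    beta p = crossClass (p.1 0).lift (p.1 1).lift (p.1 2).lift (p.1 3).lift
      - crossClass (p.1 1).lift (p.1 0).lift (p.1 2).lift (p.1 3).lift
      + crossClass (p.1 2).lift (p.1 0).lift (p.1 1).lift (p.1 3).lift
      - crossClass (p.1 3).lift (p.1 0).lift (p.1 1).lift (p.1 2).lift := by
  have h : ∀ (i j k l : Fin 4) (h), PreBloch.of (zInv p i j k l h) =
      crossClass (p.1 i).lift (p.1 j).lift (p.1 k).lift (p.1 l).lift := fun i j k l h =>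
    (blochClass_coe _).symm
  rw [beta, h, h, h, h, crossClass_swap_right (p.1 1).lift (p.1 0).lift (p.1 2).lift,
    p.2.crossClass_swap_left (i := 2) (j := 0) (k := 3) (l := 1) (by decide) (by decide)
      (by decide) (by decide),
    crossClass_swap_right (p.1 2).lift (p.1 0).lift (p.1 1).lift,
    p.2.crossClass_swap_left (i := 3) (j := 1) (k := 2) (l := 0) (by decide) (by decide)
      (by decide) (by decide),
    crossClass_swap_right (p.1 3).lift (p.1 1).lift (p.1 0).lift,
    p.2.crossClass_swap_left (i := 3) (j := 0) (k := 1) (l := 2) (by decide) (by decide)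
      (by decide) (by decide)]
  abel

theorem Generic.crossClass_vertex {p : Fin 5 → S3} (hp : Generic p) (i j k l m : Fin 5)
    (h : i ≠ j ∧ i ≠ k ∧ i ≠ l ∧ i ≠ m ∧ j ≠ k ∧ j ≠ l ∧ j ≠ m ∧ k ≠ l ∧ k ≠ m ∧ l ≠ m) :
    crossClass (p i).lift (p j).lift (p k).lift (p l).lift
      - crossClass (p i).lift (p j).lift (p k).lift (p m).lift
      + crossClass (p i).lift (p j).lift (p l).lift (p m).lift
      - crossClass (p i).lift (p k).lift (p l).lift (p m).lift
      = blochClass ((tri (p i).lift (p k).lift (p l).lift * tri (p i).lift (p j).lift (p m).lift) /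
        (tri (p i).lift (p k).lift (p m).lift * tri (p i).lift (p j).lift (p l).lift)) := by
  obtain ⟨h1, h2, h3, h4, h5, h6, h7, h8, h9, h10⟩ := h
  exact SphericalCR.crossClass_vertex (herm_lift_self _) (hp.herm_ne_zero h1.symm)
    (hp.herm_ne_zero h2.symm) (hp.herm_ne_zero h3.symm) (hp.herm_ne_zero h4.symm)
    (hp.tri_ne_zero h1 h2 h5) (hp.tri_ne_zero h1 h3 h6) (hp.tri_ne_zero h1 h4 h7)
    (hp.tri_ne_zero h2 h3 h8) (hp.tri_ne_zero h2 h4 h9) (hp.tri_ne_zero h3 h4 h10)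

/-- `β` is a cocycle. -/
theorem sum_beta_face (p : GenericTuple 5) :
    ∑ i : Fin 5, (-1 : ℤ) ^ (i : ℕ) •
      beta ⟨p.1 ∘ i.succAbove, p.2.comp Fin.succAbove_right_injective⟩ = 0 := by
  -- One relation for each vertex: the terms with a given first argument come from the four faces
  -- containing that vertex.
  have v0 := p.2.crossClass_vertex 0 1 2 3 4 (by decide)
  have v1 := p.2.crossClass_vertex 1 0 2 3 4 (by decide)
  have v2 := p.2.crossClass_vertex 2 0 1 3 4 (by decide)
  have v3 := p.2.crossClass_vertex 3 0 1 2 4 (by decide)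
  have v4 := p.2.crossClass_vertex 4 0 1 2 3 (by decide)
  have ht : ∀ i j k : Fin 5, i ≠ j ∧ i ≠ k ∧ j ≠ k →
      tri (p.1 i).lift (p.1 j).lift (p.1 k).lift ≠ 0 := fun i j k h =>
    p.2.tri_ne_zero h.1 h.2.1 h.2.2
  have hP := blochClass_plane (ht 0 1 2 (by decide)) (ht 0 1 3 (by decide)) (ht 0 1 4 (by decide))
    (ht 0 2 3 (by decide)) (ht 0 2 4 (by decide)) (ht 0 3 4 (by decide)) (ht 1 2 3 (by decide))
    (ht 1 2 4 (by decide)) (ht 1 3 4 (by decide)) (ht 2 3 4 (by decide))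
  rw [← v0, ← v1, ← v2, ← v3, ← v4] at hP
  simp only [Fin.sum_univ_five, beta_eq]
  change (-1 : ℤ) ^ 0 • (crossClass (p.1 1).lift (p.1 2).lift (p.1 3).lift (p.1 4).lift
      - crossClass (p.1 2).lift (p.1 1).lift (p.1 3).lift (p.1 4).lift
      + crossClass (p.1 3).lift (p.1 1).lift (p.1 2).lift (p.1 4).lift
      - crossClass (p.1 4).lift (p.1 1).lift (p.1 2).lift (p.1 3).lift)
    + (-1 : ℤ) ^ 1 • (crossClass (p.1 0).lift (p.1 2).lift (p.1 3).lift (p.1 4).lift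
      - crossClass (p.1 2).lift (p.1 0).lift (p.1 3).lift (p.1 4).lift
      + crossClass (p.1 3).lift (p.1 0).lift (p.1 2).lift (p.1 4).lift
      - crossClass (p.1 4).lift (p.1 0).lift (p.1 2).lift (p.1 3).lift)
    + (-1 : ℤ) ^ 2 • (crossClass (p.1 0).lift (p.1 1).lift (p.1 3).lift (p.1 4).lift
      - crossClass (p.1 1).lift (p.1 0).lift (p.1 3).lift (p.1 4).lift
      + crossClass (p.1 3).lift (p.1 0).lift (p.1 1).lift (p.1 4).lift
      - crossClass (p.1 4).lift (p.1 0).lift (p.1 1).lift (p.1 3).lift)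
    + (-1 : ℤ) ^ 3 • (crossClass (p.1 0).lift (p.1 1).lift (p.1 2).lift (p.1 4).lift
      - crossClass (p.1 1).lift (p.1 0).lift (p.1 2).lift (p.1 4).lift
      + crossClass (p.1 2).lift (p.1 0).lift (p.1 1).lift (p.1 4).lift
      - crossClass (p.1 4).lift (p.1 0).lift (p.1 1).lift (p.1 2).lift)
    + (-1 : ℤ) ^ 4 • (crossClass (p.1 0).lift (p.1 1).lift (p.1 2).lift (p.1 3).lift
      - crossClass (p.1 1).lift (p.1 0).lift (p.1 2).lift (p.1 3).lift
      + crossClass (p.1 2).lift (p.1 0).lift (p.1 1).lift (p.1 3).lift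
      - crossClass (p.1 3).lift (p.1 0).lift (p.1 1).lift (p.1 2).lift) = 0
  rw [pow_zero, pow_one, neg_one_sq, show (-1 : ℤ) ^ 3 = -1 by norm_num,
    show (-1 : ℤ) ^ 4 = 1 by norm_num, one_zsmul, neg_one_zsmul, one_zsmul, neg_one_zsmul, one_zsmul,
    ← hP]
  abel

/-! ### Invariance under the unitary group -/

theorem herm_map (A : U21) (v w : C21) :
    herm ((A : C21 ≃ₗ[ℂ] C21) v) ((A : C21 ≃ₗ[ℂ] C21) w) = herm v w := A.2 v w

theorem tri_eq_det (u v w : C21) : tri u v w = (Matrix.of ![u, v, w]).det := by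
  rw [tri_eq, Matrix.det_fin_three]
  simp
  ring

theorem tri_map (A : C21 ≃ₗ[ℂ] C21) (u v w : C21) :
    tri (A u) (A v) (A w) = tri u v w * LinearMap.det (A : C21 →ₗ[ℂ] C21) := by
  have h : Matrix.of ![A u, A v, A w] =
      Matrix.of ![u, v, w] * (LinearMap.toMatrix' (A : C21 →ₗ[ℂ] C21)).transpose := by
    have hr : ∀ (x : C21) (j : Fin 3), A x j =
        ∑ k, x k * LinearMap.toMatrix' (A : C21 →ₗ[ℂ] C21) j k := by
      intro x j
      have := congrFun (LinearMap.toMatrix'_mulVec (A : C21 →ₗ[ℂ] C21) x) j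
      simp only [LinearEquiv.coe_coe] at this
      rw [← this]
      simp [Matrix.mulVec, dotProduct, mul_comm]
    ext i j
    rw [Matrix.mul_apply]
    fin_cases i
    · exact hr u j
    · exact hr v j
    · exact hr w j
  rw [tri_eq_det, tri_eq_det, h, Matrix.det_mul, Matrix.det_transpose, LinearMap.det_toMatrix']

theorem tri_smul (a b c : ℂ) (u v w : C21) :
    tri (a • u) (b • v) (c • w) = a * b * c * tri u v w := by
  simp [tri_eq]; ring

theorem vecCross_smul {a b c d : ℂ} (ha : a ≠ 0) (hb : b ≠ 0) (hc : c ≠ 0) (hd : d ≠ 0)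
    (u v w x : C21) : vecCross (a • u) (b • v) (c • w) (d • x) = vecCross u v w x := by
  have ha' : conj a ≠ 0 := by simpa using ha
  simp only [vecCross, tri_smul, herm_smul_left, herm_smul_right]
  have e1 : a * b * d * tri u v x * (conj a * (c * herm w u)) =
    (a * b * d * c * conj a) * (tri u v x * herm w u) := by ring
  have e2 : a * b * c * tri u v w * (conj a * (d * herm x u)) =
    (a * b * d * c * conj a) * (tri u v w * herm x u) := by ring
  rw [e1, e2, mul_div_mul_left _ _ (by positivity)]

theorem exists_lift_smul (A : U21) (p : S3) :
    ∃ a : ℂ, a ≠ 0 ∧ (A • p).lift = a • (A : C21 ≃ₗ[ℂ] C21) p.lift := by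
  have e : (A • p).1 = Projectivization.mk ℂ ((A : C21 ≃ₗ[ℂ] C21) p.1.rep)
      (by simpa using p.1.rep_nonzero) := by
    change A • p.1 = _
    conv_lhs => rw [← p.1.mk_rep]
    rfl
  obtain ⟨a, ha⟩ := Projectivization.exists_smul_eq_mk_rep ℂ ((A : C21 ≃ₗ[ℂ] C21) p.1.rep)
    (by simpa using p.1.rep_nonzero)
  refine ⟨a, a.ne_zero, ?_⟩
  rw [S3.lift, e, ← ha]
  rfl

theorem crossRatio_smul (g : PU21) (a b c d : S3) :
    crossRatio (g • a) (g • b) (g • c) (g • d) = crossRatio a b c d := by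
  obtain ⟨_, A, rfl⟩ := g
  change crossRatio (A • a) (A • b) (A • c) (A • d) = _
  obtain ⟨ka, ha, ea⟩ := exists_lift_smul A a
  obtain ⟨kb, hb, eb⟩ := exists_lift_smul A b
  obtain ⟨kc, hc, ec⟩ := exists_lift_smul A c
  obtain ⟨kd, hd, ed⟩ := exists_lift_smul A d
  rw [crossRatio_eq, ea, eb, ec, ed, vecCross_smul ha hb hc hd, crossRatio_eq, vecCross, vecCross]
  simp only [tri_map, herm_map]
  have hdet : LinearMap.det ((A : C21 ≃ₗ[ℂ] C21) : C21 →ₗ[ℂ] C21) ≠ 0 :=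
    (LinearEquiv.isUnit_det' (A : C21 ≃ₗ[ℂ] C21)).ne_zero
  rw [mul_right_comm, mul_right_comm _ _ (herm d.lift a.lift), mul_div_mul_right _ _ hdet]

theorem beta_smul (g : PU21) (p : GenericTuple 4) :
    beta ⟨fun i => g • p.1 i, p.2.smul g⟩ = beta p := by
  have h : ∀ (i j k l : Fin 4) (h), zInv ⟨fun i => g • p.1 i, p.2.smul g⟩ i j k l h =
      zInv p i j k l h := fun i j k l h => Subtype.ext (crossRatio_smul g _ _ _ _)
  simp only [beta, h]

/-- The homomorphism `C_3(S³)_G → 𝒫(ℂ)` induced by `β`. -/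
def betaCoinv : Coinv 3 →+ PreBloch ℂ :=
  QuotientAddGroup.lift _ (FreeAbelianGroup.lift beta) <| by
    rw [coinvKer, AddSubgroup.closure_le]
    rintro _ ⟨g, m, rfl⟩
    have h : (FreeAbelianGroup.lift beta).comp (act 3 g) = FreeAbelianGroup.lift beta := by
      ext p
      simp only [AddMonoidHom.comp_apply, act, FreeAbelianGroup.map_of_apply,
        FreeAbelianGroup.lift_apply_of]
      exact beta_smul g p
    have := DFunLike.congr_fun h m
    rw [SetLike.mem_coe, AddMonoidHom.mem_ker, map_sub, sub_eq_zero]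
    exact this

theorem betaCoinv_comp_dBar : betaCoinv.comp (dBar 3) = 0 := by
  ext p
  change betaCoinv (QuotientAddGroup.mk (d 3 (FreeAbelianGroup.of p))) = 0
  change FreeAbelianGroup.lift beta (d 3 (FreeAbelianGroup.of p)) = 0
  rw [d, FreeAbelianGroup.lift_apply_of, map_sum, ← sum_beta_face p]
  refine Finset.sum_congr rfl fun i _ => ?_
  rw [map_zsmul, FreeAbelianGroup.lift_apply_of]

/-- The homomorphism `c : C_3(S³)_G / Im(d̄_4) → 𝒫(ℂ)`. -/
def configHom : ConfigQuotient →+ PreBloch ℂ :=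
  QuotientAddGroup.lift _ betaCoinv <| by
    rintro _ ⟨x, rfl⟩
    exact DFunLike.congr_fun betaCoinv_comp_dBar x

theorem configHom_configClass (p : GenericTuple 4) : configHom (configClass p) = beta p := by
  change FreeAbelianGroup.lift beta (FreeAbelianGroup.of p) = beta p
  rw [FreeAbelianGroup.lift_apply_of]

/-! ## The volume of a configuration is a sum over its faces -/

/-- The five-term relations for (z, 2) and (-1, 1-z) have the same last three terms up to order, and
`D` vanishes at the real numbers 2 and -1. -/
theorem blochWigner_one_sub (z : ℂ) : blochWigner (1 - z) = -blochWigner z := by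
  by_cases h0 : z = 0
  · simp [h0]
  by_cases h1 : z = 1
  · simp [h1]
  have hz : 1 - z ≠ 0 := sub_ne_zero.2 (Ne.symm h1)
  have f1 := fiveTermSum_eq_zero h0 (y := 2) (by norm_num)
  have f2 := fiveTermSum_eq_zero (x := 1 - 2) (by norm_num) hz
  have e : (1 - (1 - 2 : ℂ)⁻¹) / (1 - (1 - z)⁻¹) = (1 - z⁻¹) / (1 - 2⁻¹) := by
    have e1 : 1 - (1 - z)⁻¹ = -z / (1 - z) := by field_simp; ring
    have e2 : 1 - z⁻¹ = -(1 - z) / z := by field_simp; ring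
    rw [e1, e2]
    field_simp
    norm_num
  have hr1 := blochWigner_ofReal 2
  have hr2 := blochWigner_ofReal (1 - 2)
  push_cast at hr1 hr2
  rw [fiveTermSum, hr1] at f1
  rw [fiveTermSum, e, hr2, sub_sub_cancel, sub_sub_cancel] at f2
  linarith

/-- The five-term relation for (a, ab), in a form symmetric in a and b. -/
theorem blochWigner_add_of_mul_ne_one {a b : ℂ} (ha0 : a ≠ 0) (hb0 : b ≠ 0) (h : a * b ≠ 1) :
    blochWigner a + blochWigner b = blochWigner (a * b)
      - blochWigner ((1 - a) / (1 - a * b)) - blochWigner ((1 - b) / (1 - a * b)) := by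
  have he : 1 - a * b ≠ 0 := sub_ne_zero.2 h.symm
  have f := fiveTermSum_eq_zero ha0 (mul_ne_zero ha0 hb0)
  have e : (1 - a⁻¹) / (1 - (a * b)⁻¹) = 1 - (1 - b) / (1 - a * b) := by
    have e1 : 1 - (a * b)⁻¹ = -(1 - a * b) / (a * b) := by field_simp; ring
    rw [e1]
    field_simp
    ring
  rw [fiveTermSum, e, blochWigner_one_sub, mul_div_cancel_left₀ _ ha0] at f
  linarith

/-- The five-term relation for (p, q), with u = p/q and w = (1-p)/(1-q) given by equations so that
simplified expressions can be supplied. -/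
theorem blochWigner_sub_of_ratio {p q u : ℂ} (hp : p ≠ 0) (hq : q ≠ 0) (hu : u * q = p) {w : ℂ}
    (hw : w * (1 - q) = 1 - p) (h1 : 1 - q ≠ 0) :
    blochWigner p - blochWigner q = blochWigner u + blochWigner (w / u) - blochWigner w := by
  have hu0 : u ≠ 0 := by rintro rfl; exact hp (by rw [← hu, zero_mul])
  have f := fiveTermSum_eq_zero hp hq
  have e1 : q / p = u⁻¹ := by rw [← hu]; field_simp
  have e2 : (1 - p) / (1 - q) = w := by rw [← hw]; field_simp
  have e3 : (1 - p⁻¹) / (1 - q⁻¹) = w / u := by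
    have i1 : 1 - p⁻¹ = -(1 - p) / p := by field_simp; ring
    have i2 : 1 - q⁻¹ = -(1 - q) / q := by field_simp; ring
    rw [i1, i2, ← hw, ← hu]; field_simp
  rw [fiveTermSum, e1, e2, e3, blochWigner_inv] at f
  linarith

/-- Since ab = cd, expanding D(a)+D(b) and D(c)+D(d) by the symmetric five-term relation cancels the
term of the common product. The four values left have common denominator 1 - ab and pair off with
ratios u and u'. Two more five-term relations leave D(u)+D(u'), which is zero, two mutually
cancelling values, and the right-hand side. -/
theorem blochWigner_four_term {a b c d u u' : ℂ} (ha0 : a ≠ 0) (hb0 : b ≠ 0) (hc0 : c ≠ 0)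
    (hd0 : d ≠ 0) (ha1 : 1 - a ≠ 0) (hb1 : 1 - b ≠ 0) (hc1 : 1 - c ≠ 0) (hd1 : 1 - d ≠ 0)
    (h : a * b = c * d) (hu : u * (1 - d) = 1 - a) (hu' : u' * (1 - c) = 1 - b)
    (huu' : blochWigner u' = -blochWigner u) :
    blochWigner a + blochWigner b - blochWigner c - blochWigner d =
      blochWigner (a / d * u') - blochWigner (a / d / u) := by
  have hu0 : u ≠ 0 := by rintro rfl; exact ha1 (by rw [← hu, zero_mul])
  have hu0' : u' ≠ 0 := by rintro rfl; exact hb1 (by rw [← hu', zero_mul])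
  -- When 1 - ab vanishes the expansion is unavailable. Then b = 1/a and c = 1/d make the left side
  -- zero, and the right side is D(u) + D(u').
  by_cases hab : a * b = 1
  · have hb : b = a⁻¹ := eq_inv_of_mul_eq_one_right hab
    have hd : c = d⁻¹ := eq_inv_of_mul_eq_one_left (h ▸ hab)
    have hau : a / d * u' = u := by
      have e1 : u' = (1 - a⁻¹) / (1 - d⁻¹) := by
        rw [eq_div_iff (by rwa [← hd]), ← hd, hu', hb]
      have e2 : u = (1 - a) / (1 - d) := by rw [eq_div_iff hd1, hu]
      have i1 : 1 - a⁻¹ = -(1 - a) / a := by field_simp; ring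
      have i2 : 1 - d⁻¹ = -(1 - d) / d := by field_simp; ring
      rw [e1, e2, i1, i2]
      field_simp
    have hau' : a / d / u = u'⁻¹ := by
      rw [← hau]; field_simp
    rw [hau, hau', hb, hd, blochWigner_inv, blochWigner_inv, blochWigner_inv, huu']
    ring
  · have hcd : c * d ≠ 1 := h ▸ hab
    have he : 1 - a * b ≠ 0 := sub_ne_zero.2 (Ne.symm hab)
    have he' : 1 - c * d ≠ 0 := sub_ne_zero.2 (Ne.symm hcd)
    have f1 := blochWigner_add_of_mul_ne_one ha0 hb0 hab
    have f2 := blochWigner_add_of_mul_ne_one hc0 hd0 hcd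
    rw [← h] at f2
    have n1 : 1 - (1 - d) / (1 - a * b) = d * (1 - c) / (1 - a * b) := by
      field_simp; linear_combination -h
    have n2 : 1 - (1 - c) / (1 - a * b) = c * (1 - d) / (1 - a * b) := by
      field_simp; linear_combination -h
    have g1 := blochWigner_sub_of_ratio (p := (1 - a) / (1 - a * b)) (q := (1 - d) / (1 - a * b))
      (u := u) (w := a / d * u') (div_ne_zero ha1 he) (div_ne_zero hd1 he)
      (by rw [← hu]; ring) (by rw [n1]; field_simp; linear_combination a * hu')
      (by rw [n1]; exact div_ne_zero (mul_ne_zero hd0 hc1) he)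
    have g2 := blochWigner_sub_of_ratio (p := (1 - b) / (1 - a * b)) (q := (1 - c) / (1 - a * b))
      (u := u') (w := (a / d / u)⁻¹) (div_ne_zero hb1 he) (div_ne_zero hc1 he)
      (by rw [← hu']; ring)
      (by
        rw [n2]
        field_simp
        linear_combination (-u * (1 - d)) * h + a * b * hu)
      (by rw [n2]; exact div_ne_zero (mul_ne_zero hc0 hd1) he)
    have e : (a / d / u)⁻¹ / u' = (a / d * u' / u)⁻¹ := by field_simp
    rw [e, blochWigner_inv, blochWigner_inv] at g2
    linarith

/-- The five-term relation for (z, z̄); the three remaining arguments are quotients of a number and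
its conjugate. -/
theorem two_mul_blochWigner {z : ℂ} (hz : z ≠ 0) :
    2 * blochWigner z = -blochWigner (conj z / z)
      + blochWigner ((1 - z⁻¹) / (1 - (conj z)⁻¹)) - blochWigner ((1 - z) / (1 - conj z)) := by
  have f := fiveTermSum_eq_zero hz (y := conj z) (by simpa using hz)
  rw [fiveTermSum, blochWigner_conj] at f
  linarith

/-- If the unit complex number `(1-z)/(1-z̄)` is `w`, then twice `D(z)` is a sum of values of `D` on
the unit circle. -/
theorem two_mul_blochWigner_of_ratio {z w : ℂ} (hz : z ≠ 0) (h1 : z ≠ 1)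
    (hw : w * (1 - conj z) = 1 - z) :
    2 * blochWigner z = -blochWigner (conj z / z) + blochWigner (w * (conj z / z))
      - blochWigner w := by
  have hz' : conj z ≠ 0 := by simpa using hz
  have h1' : 1 - conj z ≠ 0 := sub_ne_zero.2 fun h => h1 <| by
    have := congrArg conj h
    simpa using this.symm
  have e1 : (1 - z) / (1 - conj z) = w := by rw [← hw]; field_simp
  have e2 : (1 - z⁻¹) / (1 - (conj z)⁻¹) = w * (conj z / z) := by
    have i1 : 1 - z⁻¹ = -(1 - z) / z := by field_simp; ring
    have i2 : 1 - (conj z)⁻¹ = -(1 - conj z) / conj z := by field_simp; ring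
    rw [i1, i2, ← hw]; field_simp
  rw [two_mul_blochWigner hz, e1, e2]

/-! ### Triple products and the face formula -/

/-- The Gram determinant is |det(u,v,w)|² times the determinant -1 of the form. For null vectors
only the two cyclic products survive. -/
theorem tri_mul_conj_tri {u v w : C21} (hu : herm u u = 0) (hv : herm v v = 0)
    (hw : herm w w = 0) :
    tri u v w * conj (tri u v w) =
      -(herm u v * herm v w * herm w u + herm u w * herm w v * herm v u) := by
  have h : tri u v w * conj (tri u v w) =
      -(herm u v * herm v w * herm w u + herm u w * herm w v * herm v u
        + herm u u * herm v v * herm w w - herm u u * herm v w * herm w v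
        - herm v v * herm u w * herm w u - herm w w * herm u v * herm v u) := by
    simp only [tri_eq, herm_eq, map_add, map_sub, map_mul]
    ring
  rw [h, hu, hv, hw]
  ring

/-- The Cartan triple product of three vectors. -/
def triple (u v w : C21) : ℂ := herm u v * herm v w * herm w u

/-- The value of the Bloch-Wigner function at `-H / H̄`, where `H` is the Cartan triple product. -/
def faceVolume (u v w : C21) : ℝ := blochWigner (-triple u v w / conj (triple u v w))

theorem conj_triple (u v w : C21) : conj (triple u v w) = herm v u * herm w v * herm u w := by
  simp [triple, herm_conj]

theorem two_mul_volume {v₀ v₁ v₂ v₃ : C21} (h₀ : herm v₀ v₀ = 0) (h₁ : herm v₁ v₁ = 0)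
    (h₂ : herm v₂ v₂ = 0) (h₃ : herm v₃ v₃ = 0) (t₀ : tri v₁ v₂ v₃ ≠ 0) (t₁ : tri v₀ v₂ v₃ ≠ 0)
    (t₂ : tri v₀ v₁ v₃ ≠ 0) (t₃ : tri v₀ v₁ v₂ ≠ 0) (n₀₁ : herm v₀ v₁ ≠ 0) (n₀₂ : herm v₀ v₂ ≠ 0)
    (n₀₃ : herm v₀ v₃ ≠ 0) (n₁₂ : herm v₁ v₂ ≠ 0) (n₁₃ : herm v₁ v₃ ≠ 0) (n₂₃ : herm v₂ v₃ ≠ 0) :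
    2 * (blochWigner (vecCross v₀ v₁ v₂ v₃) + blochWigner (vecCross v₁ v₀ v₃ v₂)
      + blochWigner (vecCross v₂ v₃ v₀ v₁) + blochWigner (vecCross v₃ v₂ v₁ v₀)) =
    faceVolume v₁ v₂ v₃ - faceVolume v₀ v₂ v₃ + faceVolume v₀ v₁ v₃ - faceVolume v₀ v₁ v₂ := by
  have m : ∀ {v w : C21}, herm v w ≠ 0 → herm w v ≠ 0 := fun {v w} h => by
    rw [← herm_conj]; simpa using h
  have n₁₀ := m n₀₁
  have n₂₀ := m n₀₂
  have n₃₀ := m n₀₃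
  have n₂₁ := m n₁₂
  have n₃₁ := m n₁₃
  have n₃₂ := m n₂₃
  -- Cramer's rule paired with each vertex yields 1-a, 1-b, 1-c, 1-d; the last two relations are
  -- conjugated because c and d are conjugates of cross-ratios.
  have c₀ := tri_mul_herm v₀ v₁ v₂ v₃ v₀
  have c₁ := tri_mul_herm v₀ v₁ v₂ v₃ v₁
  have c₂ := congrArg conj (tri_mul_herm v₀ v₁ v₂ v₃ v₂)
  have c₃ := congrArg conj (tri_mul_herm v₀ v₁ v₂ v₃ v₃)
  simp only [map_add, map_sub, map_mul, map_zero, herm_conj] at c₂ c₃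
  have N₀ := tri_mul_conj_tri h₁ h₂ h₃
  have N₁ := tri_mul_conj_tri h₀ h₂ h₃
  have N₂ := tri_mul_conj_tri h₀ h₁ h₃
  have N₃ := tri_mul_conj_tri h₀ h₁ h₂
  have m₀ : conj (tri v₁ v₂ v₃) ≠ 0 := by simpa using t₀
  have m₁ : conj (tri v₀ v₂ v₃) ≠ 0 := by simpa using t₁
  have m₂ : conj (tri v₀ v₁ v₃) ≠ 0 := by simpa using t₂
  have m₃ : conj (tri v₀ v₁ v₂) ≠ 0 := by simpa using t₃
  set a := vecCross v₀ v₁ v₂ v₃ with ha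
  set b := vecCross v₁ v₀ v₃ v₂ with hb
  set c := conj (vecCross v₂ v₃ v₀ v₁) with hc
  set d := conj (vecCross v₃ v₂ v₁ v₀) with hd
  have eb : b = tri v₀ v₁ v₂ * herm v₃ v₁ / (tri v₀ v₁ v₃ * herm v₂ v₁) := by
    rw [hb, vecCross, tri_swap_left v₀ v₁ v₂, tri_swap_left v₀ v₁ v₃]; field_simp
  have ec : c = conj (tri v₁ v₂ v₃) * herm v₂ v₀ / (conj (tri v₀ v₂ v₃) * herm v₂ v₁) := by
    rw [hc, vecCross, tri_rotate v₁ v₂ v₃, tri_rotate v₀ v₂ v₃]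
    simp only [map_div₀, map_mul, herm_conj]
  have ed : d = conj (tri v₀ v₂ v₃) * herm v₃ v₁ / (conj (tri v₁ v₂ v₃) * herm v₃ v₀) := by
    rw [hd, vecCross, tri_swap_left v₂ v₃ v₀, tri_swap_left v₂ v₃ v₁, tri_rotate v₁ v₂ v₃,
      tri_rotate v₀ v₂ v₃]
    simp only [map_div₀, map_mul, herm_conj, map_neg]
    field_simp
  have ea : a = tri v₀ v₁ v₃ * herm v₂ v₀ / (tri v₀ v₁ v₂ * herm v₃ v₀) := rfl
  -- This is (1-a)/(1-d); its conjugate is (1-b)/(1-c).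
  set u := tri v₀ v₂ v₃ * herm v₁ v₀ * conj (tri v₁ v₂ v₃) /
    (tri v₀ v₁ v₂ * conj (tri v₀ v₁ v₃) * herm v₃ v₂) with hu
  have oa : 1 - a = -(tri v₀ v₂ v₃ * herm v₁ v₀) / (tri v₀ v₁ v₂ * herm v₃ v₀) := by
    rw [ea]; field_simp; rw [h₀] at c₀; linear_combination -c₀
  have ob : 1 - b = -(tri v₁ v₂ v₃ * herm v₀ v₁) / (tri v₀ v₁ v₃ * herm v₂ v₁) := by
    rw [eb]; field_simp; rw [h₁] at c₁; linear_combination c₁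
  have oc : 1 - c = -(conj (tri v₀ v₁ v₂) * herm v₂ v₃) / (conj (tri v₀ v₂ v₃) * herm v₂ v₁) := by
    rw [ec]; field_simp; rw [h₂] at c₂; linear_combination -c₂
  have od : 1 - d = -(conj (tri v₀ v₁ v₃) * herm v₃ v₂) / (conj (tri v₁ v₂ v₃) * herm v₃ v₀) := by
    rw [ed]; field_simp; rw [h₃] at c₃; linear_combination c₃
  have eu' : conj u = conj (tri v₀ v₂ v₃) * herm v₀ v₁ * tri v₁ v₂ v₃ /
      (conj (tri v₀ v₁ v₂) * tri v₀ v₁ v₃ * herm v₂ v₃) := by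
    rw [hu]; simp only [map_div₀, map_mul, herm_conj, Complex.conj_conj]
  have four := blochWigner_four_term (a := a) (b := b) (c := c) (d := d) (u := u) (u' := conj u)
    (by rw [ea]; positivity) (by rw [eb]; positivity) (by rw [ec]; positivity)
    (by rw [ed]; positivity)
    (by rw [oa]; exact div_ne_zero (neg_ne_zero.2 (by positivity)) (by positivity))
    (by rw [ob]; exact div_ne_zero (neg_ne_zero.2 (by positivity)) (by positivity))
    (by rw [oc]; exact div_ne_zero (neg_ne_zero.2 (by positivity)) (by positivity))
    (by rw [od]; exact div_ne_zero (neg_ne_zero.2 (by positivity)) (by positivity))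
    (by rw [ea, eb, ec, ed]; field_simp) (by rw [oa, od, hu]; field_simp)
    (by rw [ob, oc, eu']; field_simp) (blochWigner_conj u)
  set s := a / d * conj u with hs
  set t := a / d / u with ht
  have es : s = (tri v₁ v₂ v₃ * conj (tri v₁ v₂ v₃)) * (herm v₂ v₀ * herm v₀ v₁) /
      ((tri v₀ v₁ v₂ * conj (tri v₀ v₁ v₂)) * (herm v₃ v₁ * herm v₂ v₃)) := by
    rw [hs, ea, ed, eu']; field_simp
  have et : t = (tri v₀ v₁ v₃ * conj (tri v₀ v₁ v₃)) * (herm v₂ v₀ * herm v₃ v₂) /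
      ((tri v₀ v₂ v₃ * conj (tri v₀ v₂ v₃)) * (herm v₃ v₁ * herm v₁ v₀)) := by
    rw [ht, ea, ed, hu]; field_simp
  have es' : conj s = (tri v₁ v₂ v₃ * conj (tri v₁ v₂ v₃)) * (herm v₀ v₂ * herm v₁ v₀) /
      ((tri v₀ v₁ v₂ * conj (tri v₀ v₁ v₂)) * (herm v₁ v₃ * herm v₃ v₂)) := by
    rw [es]; simp only [map_div₀, map_mul, herm_conj, Complex.conj_conj]; ring
  have et' : conj t = (tri v₀ v₁ v₃ * conj (tri v₀ v₁ v₃)) * (herm v₀ v₂ * herm v₂ v₃) /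
      ((tri v₀ v₂ v₃ * conj (tri v₀ v₂ v₃)) * (herm v₁ v₃ * herm v₀ v₁)) := by
    rw [et]; simp only [map_div₀, map_mul, herm_conj, Complex.conj_conj]; ring
  -- Q' is the conjugate of Q. The Gram identities make 1-s and 1-t multiples of Q - Q', so this
  -- factor drops out, up to sign, of (1-s)/(1-s̄) and (1-t)/(1-t̄).
  set Q := herm v₀ v₁ * herm v₁ v₃ * herm v₃ v₂ * herm v₂ v₀ with hQ
  set Q' := herm v₁ v₀ * herm v₃ v₁ * herm v₂ v₃ * herm v₀ v₂ with hQ'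
  have os : 1 - s = herm v₂ v₁ * (Q - Q') /
      ((tri v₀ v₁ v₂ * conj (tri v₀ v₁ v₂)) * (herm v₃ v₁ * herm v₂ v₃)) := by
    rw [es, eq_div_iff (by positivity), sub_mul, div_mul_cancel₀ _ (by positivity), N₀, N₃]
    ring
  have ot : 1 - t = herm v₃ v₀ * (Q - Q') /
      ((tri v₀ v₂ v₃ * conj (tri v₀ v₂ v₃)) * (herm v₃ v₁ * herm v₁ v₀)) := by
    rw [et, eq_div_iff (by positivity), sub_mul, div_mul_cancel₀ _ (by positivity), N₁, N₂]
    ring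
  have os' : 1 - conj s = herm v₁ v₂ * (Q' - Q) /
      ((tri v₀ v₁ v₂ * conj (tri v₀ v₁ v₂)) * (herm v₁ v₃ * herm v₃ v₂)) := by
    rw [es', eq_div_iff (by positivity), sub_mul, div_mul_cancel₀ _ (by positivity), N₀, N₃]
    ring
  have ot' : 1 - conj t = herm v₀ v₃ * (Q' - Q) /
      ((tri v₀ v₂ v₃ * conj (tri v₀ v₂ v₃)) * (herm v₁ v₃ * herm v₀ v₁)) := by
    rw [et', eq_div_iff (by positivity), sub_mul, div_mul_cancel₀ _ (by positivity), N₁, N₂]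
    ring
  have total : blochWigner a + blochWigner b + blochWigner (vecCross v₂ v₃ v₀ v₁)
      + blochWigner (vecCross v₃ v₂ v₁ v₀) = blochWigner s - blochWigner t := by
    rw [← four, hc, hd, blochWigner_conj, blochWigner_conj]; ring
  rw [total]
  simp only [faceVolume, conj_triple]
  simp only [triple]
  -- If Q is real then s = t = 1, and the arguments of the four face terms agree in two pairs
  -- entering with opposite signs.
  by_cases hQQ : Q = Q'
  · rw [hQQ, sub_self, mul_zero, zero_div, sub_eq_zero] at os ot
    have e1 : -(herm v₁ v₂ * herm v₂ v₃ * herm v₃ v₁) / (herm v₂ v₁ * herm v₃ v₂ * herm v₁ v₃) =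
        -(herm v₀ v₁ * herm v₁ v₂ * herm v₂ v₀) / (herm v₁ v₀ * herm v₂ v₁ * herm v₀ v₂) := by
      field_simp
      linear_combination hQQ
    have e2 : -(herm v₀ v₂ * herm v₂ v₃ * herm v₃ v₀) / (herm v₂ v₀ * herm v₃ v₂ * herm v₀ v₃) =
        -(herm v₀ v₁ * herm v₁ v₃ * herm v₃ v₀) / (herm v₁ v₀ * herm v₃ v₁ * herm v₀ v₃) := by
      field_simp
      linear_combination hQQ
    rw [← os, ← ot, e1, e2]
    simp
  · have hq : Q - Q' ≠ 0 := sub_ne_zero.2 hQQ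
    have hs0 : s ≠ 0 := by rw [es]; positivity
    have ht0 : t ≠ 0 := by rw [et]; positivity
    have hs1 : s ≠ 1 := by
      intro h
      rw [h, sub_self] at os
      exact div_ne_zero (mul_ne_zero n₂₁ hq) (by positivity) os.symm
    have ht1 : t ≠ 1 := by
      intro h
      rw [h, sub_self] at ot
      exact div_ne_zero (mul_ne_zero n₃₀ hq) (by positivity) ot.symm
    have f1 := two_mul_blochWigner_of_ratio hs0 hs1
      (w := (-(herm v₁ v₂ * herm v₂ v₃ * herm v₃ v₁) / (herm v₂ v₁ * herm v₃ v₂ * herm v₁ v₃))⁻¹)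
      (by rw [os, os']; field_simp; ring)
    have f2 := two_mul_blochWigner_of_ratio ht0 ht1
      (w := -(herm v₀ v₁ * herm v₁ v₃ * herm v₃ v₀) / (herm v₁ v₀ * herm v₃ v₁ * herm v₀ v₃))
      (by rw [ot, ot']; field_simp; ring)
    -- This is the value common to 2D(s) and 2D(t); it disappears in the difference.
    have e1 : conj s / s = conj t / t := by rw [es', es, et', et]; field_simp
    have e2 : (-(herm v₁ v₂ * herm v₂ v₃ * herm v₃ v₁) /
        (herm v₂ v₁ * herm v₃ v₂ * herm v₁ v₃))⁻¹ * (conj s / s) =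
        (-(herm v₀ v₁ * herm v₁ v₂ * herm v₂ v₀) / (herm v₁ v₀ * herm v₂ v₁ * herm v₀ v₂))⁻¹ := by
      rw [es', es]; field_simp
    have e3 : -(herm v₀ v₁ * herm v₁ v₃ * herm v₃ v₀) /
        (herm v₁ v₀ * herm v₃ v₁ * herm v₀ v₃) * (conj t / t) =
        -(herm v₀ v₂ * herm v₂ v₃ * herm v₃ v₀) / (herm v₂ v₀ * herm v₃ v₂ * herm v₀ v₃) := by
      rw [et', et]; field_simp
    rw [e2, blochWigner_inv, blochWigner_inv, e1] at f1
    rw [e3] at f2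
    linarith

/-- The volume of a generic configuration is a sum over its faces. -/
theorem two_mul_blochWignerHom_beta (p : GenericTuple 4) :
    2 * blochWignerHom (beta p) =
      faceVolume (p.1 1).lift (p.1 2).lift (p.1 3).lift
      - faceVolume (p.1 0).lift (p.1 2).lift (p.1 3).lift
      + faceVolume (p.1 0).lift (p.1 1).lift (p.1 3).lift
      - faceVolume (p.1 0).lift (p.1 1).lift (p.1 2).lift := by
  have ht : ∀ i j k : Fin 4, i ≠ j ∧ i ≠ k ∧ j ≠ k →
      tri (p.1 i).lift (p.1 j).lift (p.1 k).lift ≠ 0 := fun i j k h =>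
    p.2.tri_ne_zero h.1 h.2.1 h.2.2
  have hn : ∀ i j : Fin 4, i ≠ j → herm (p.1 i).lift (p.1 j).lift ≠ 0 := fun i j h =>
    p.2.herm_ne_zero h
  rw [← two_mul_volume (herm_lift_self _) (herm_lift_self _) (herm_lift_self _) (herm_lift_self _)
    (ht 1 2 3 (by decide)) (ht 0 2 3 (by decide)) (ht 0 1 3 (by decide)) (ht 0 1 2 (by decide))
    (hn 0 1 (by decide)) (hn 0 2 (by decide)) (hn 0 3 (by decide)) (hn 1 2 (by decide))
    (hn 1 3 (by decide)) (hn 2 3 (by decide))]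
  simp only [beta, map_add, blochWignerHom_of]
  rfl

/-! ## The sum over the faces -/

/-- The contribution of a face to the volume, as a function of its vertices. -/
def triangleVolume (q : Fin 3 → S3) : ℝ := faceVolume (q 0).lift (q 1).lift (q 2).lift

theorem faceVolume_swap_left (u v w : C21) : faceVolume v u w = -faceVolume u v w := by
  have h : triple v u w = conj (triple u v w) := by rw [conj_triple, triple]; ring
  rw [faceVolume, faceVolume, h, Complex.conj_conj, ← blochWigner_inv, inv_div, neg_div, div_neg]

theorem faceVolume_swap_right (u v w : C21) : faceVolume u w v = -faceVolume u v w := by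
  have h : triple u w v = conj (triple u v w) := by rw [conj_triple, triple]; ring
  rw [faceVolume, faceVolume, h, Complex.conj_conj, ← blochWigner_inv, inv_div, neg_div, div_neg]

theorem triangleVolume_perm (q : Fin 3 → S3) (τ : Equiv.Perm (Fin 3)) :
    triangleVolume (q ∘ τ) = (Equiv.Perm.sign τ : ℤ) * triangleVolume q := by
  have hτ : ∀ τ : Equiv.Perm (Fin 3), τ = 1 ∨ τ = Equiv.swap 0 1 ∨ τ = Equiv.swap 1 2 ∨
      τ = Equiv.swap 0 2 ∨ τ = Equiv.swap 0 1 * Equiv.swap 1 2 ∨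
      τ = Equiv.swap 1 2 * Equiv.swap 0 1 := by decide
  have s₁ : ∀ q : Fin 3 → S3, triangleVolume (q ∘ Equiv.swap 0 1) = -triangleVolume q := fun q =>
    faceVolume_swap_left _ _ _
  have s₂ : ∀ q : Fin 3 → S3, triangleVolume (q ∘ Equiv.swap 1 2) = -triangleVolume q := fun q =>
    faceVolume_swap_right _ _ _
  have e : Equiv.swap (0 : Fin 3) 2 = Equiv.swap 0 1 * Equiv.swap 1 2 * Equiv.swap 0 1 := by decide
  rcases hτ τ with rfl | rfl | rfl | rfl | rfl | rfl
  · simp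
  · rw [s₁, Equiv.Perm.sign_swap (by decide)]; simp
  · rw [s₂, Equiv.Perm.sign_swap (by decide)]; simp
  · rw [Equiv.Perm.sign_swap (by decide), e]
    simp only [Equiv.Perm.coe_mul, ← Function.comp_assoc, s₁, s₂]
    simp
  · rw [map_mul, Equiv.Perm.sign_swap (by decide), Equiv.Perm.sign_swap (by decide)]
    simp only [Equiv.Perm.coe_mul, ← Function.comp_assoc, s₁, s₂]
    simp
  · rw [map_mul, Equiv.Perm.sign_swap (by decide), Equiv.Perm.sign_swap (by decide)]
    simp only [Equiv.Perm.coe_mul, ← Function.comp_assoc, s₁, s₂]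
    simp

theorem triangleVolume_smul (g : PU21) (q : Fin 3 → S3) :
    triangleVolume (fun j => g • q j) = triangleVolume q := by
  obtain ⟨_, A, rfl⟩ := g
  change triangleVolume (fun j => A • q j) = _
  obtain ⟨a, ha, ea⟩ := exists_lift_smul A (q 0)
  obtain ⟨b, hb, eb⟩ := exists_lift_smul A (q 1)
  obtain ⟨c, hc, ec⟩ := exists_lift_smul A (q 2)
  have ha' : conj a ≠ 0 := by simpa using ha
  have hb' : conj b ≠ 0 := by simpa using hb
  have hc' : conj c ≠ 0 := by simpa using hc
  rw [triangleVolume, triangleVolume, faceVolume, faceVolume, ea, eb, ec, conj_triple, conj_triple,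
    triple, triple]
  simp only [herm_smul_left, herm_smul_right, herm_map]
  congr 1
  set x := herm (q 0).lift (q 1).lift
  set y := herm (q 1).lift (q 2).lift
  set z := herm (q 2).lift (q 0).lift
  set x' := herm (q 1).lift (q 0).lift
  set y' := herm (q 2).lift (q 1).lift
  set z' := herm (q 0).lift (q 2).lift
  rw [← mul_div_mul_left (-(x * y * z)) (x' * y' * z')
    (show a * b * c * conj a * conj b * conj c ≠ 0 by positivity)]
  congr 1 <;> ring

/-- The signed contribution to the volume of the face of a tetrahedron opposite to a vertex. -/
def signedFace (q : Fin 4 → S3) (f : Fin 4) : ℝ :=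
  (-1) ^ (f : ℕ) * triangleVolume (q ∘ f.succAbove)

theorem two_mul_blochWignerHom_beta_eq_sum (p : GenericTuple 4) :
    2 * blochWignerHom (beta p) = ∑ f, signedFace p.1 f := by
  rw [two_mul_blochWignerHom_beta, Fin.sum_univ_four]
  have h : ∀ f : Fin 4, signedFace p.1 f = (-1) ^ (f : ℕ) * faceVolume (p.1 (f.succAbove 0)).lift
    (p.1 (f.succAbove 1)).lift (p.1 (f.succAbove 2)).lift := fun _ => rfl
  simp only [h]
  change _ = (-1) ^ 0 * faceVolume (p.1 1).lift (p.1 2).lift (p.1 3).lift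
    + (-1) ^ 1 * faceVolume (p.1 0).lift (p.1 2).lift (p.1 3).lift
    + (-1) ^ 2 * faceVolume (p.1 0).lift (p.1 1).lift (p.1 3).lift
    + (-1) ^ 3 * faceVolume (p.1 0).lift (p.1 1).lift (p.1 2).lift
  ring

/-- Here τ is the inverse of the bijection that σ induces between the two faces, their vertices
being listed increasingly. Moving f and σ(f) to the front gives sign σ = (-1)^(f + σ f) sign τ. -/
theorem exists_perm_succAbove : ∀ (σ : Equiv.Perm (Fin 4)) (f : Fin 4), Equiv.Perm.sign σ = -1 →
    ∃ τ : Equiv.Perm (Fin 3), (∀ j, σ (f.succAbove (τ j)) = (σ f).succAbove j) ∧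
      (-1 : ℤ) ^ ((σ f : Fin 4) : ℕ) * (Equiv.Perm.sign τ : ℤ) = -(-1) ^ (f : ℕ) := by
  decide

/-- An orientation-reversing gluing of two faces by an element of `PU(2,1)` cancels their
contributions. -/
theorem signedFace_of_gluing {q q' : Fin 4 → S3} {f : Fin 4} {σ : Equiv.Perm (Fin 4)}
    (hσ : Equiv.Perm.sign σ = -1) (g : PU21) (h : ∀ v, v ≠ f → q' (σ v) = g • q v) :
    signedFace q' (σ f) = -signedFace q f := by
  obtain ⟨τ, h1, h2⟩ := exists_perm_succAbove σ f hσ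
  have e : q' ∘ (σ f).succAbove = fun j => g • (q ∘ f.succAbove ∘ τ) j := by
    ext1 j
    rw [Function.comp_apply, ← h1, h _ (Fin.succAbove_ne f _)]
    rfl
  rw [signedFace, signedFace, e, triangleVolume_smul, ← Function.comp_assoc, triangleVolume_perm]
  have h2' : (-1 : ℝ) ^ ((σ f : Fin 4) : ℕ) * ((Equiv.Perm.sign τ : ℤ) : ℝ) = -(-1) ^ (f : ℕ) := by
    exact_mod_cast congrArg (Int.cast : ℤ → ℝ) h2
  linear_combination triangleVolume (q ∘ f.succAbove) * h2'

/-! ## The topology of the sphere and rigidity -/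

/-- The point of the projective plane given by a nonzero vector. -/
def toProj (v : {v : C21 // v ≠ 0}) : ℙ ℂ C21 := Projectivization.mk ℂ v.1 v.2

theorem isQuotientMap_toProj : Topology.IsQuotientMap toProj := isQuotientMap_quot_mk

/-- The point of the sphere given by a nonzero null vector. -/
def S3.mk (v : C21) (hv : v ≠ 0) (h : herm v v = 0) : S3 :=
  ⟨Projectivization.mk ℂ v hv, (null_rep_mk hv).2 h⟩

theorem S3.mk_lift (p : S3) : S3.mk p.lift (lift_ne_zero p) (herm_lift_self p) = p :=
  Subtype.ext p.1.mk_rep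

theorem S3.mk_eq_mk {v w : C21} {hv : v ≠ 0} {hv' : herm v v = 0} {hw : w ≠ 0} {hw' : herm w w = 0} :
    S3.mk v hv hv' = S3.mk w hw hw' ↔ ∃ a : ℂ, a • w = v := by
  rw [S3.mk, S3.mk, Subtype.mk.injEq, Projectivization.mk_eq_mk_iff']

theorem smul_mk (A : U21) {v : C21} (hv : v ≠ 0) (h : herm v v = 0) :
    A • S3.mk v hv h = S3.mk ((A : C21 ≃ₗ[ℂ] C21) v) (by simpa using hv) (by rwa [herm_map]) :=
  Subtype.ext rfl

theorem continuous_smul_S3 (g : PU21) : Continuous fun p : S3 => g • p := by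
  obtain ⟨_, A, rfl⟩ := g
  have h : Continuous fun p : ℙ ℂ C21 => A • p := by
    rw [isQuotientMap_toProj.continuous_iff]
    have hA : Continuous (A : C21 ≃ₗ[ℂ] C21) :=
      LinearMap.continuous_of_finiteDimensional ((A : C21 ≃ₗ[ℂ] C21) : C21 →ₗ[ℂ] C21)
    have h2 : Continuous fun v : {v : C21 // v ≠ 0} =>
        (⟨(A : C21 ≃ₗ[ℂ] C21) v.1, by simpa using v.2⟩ : {v : C21 // v ≠ 0}) :=
      (hA.comp continuous_subtype_val).subtype_mk _
    exact isQuotientMap_toProj.continuous.comp h2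
  exact (h.comp continuous_subtype_val).subtype_mk _

theorem continuous_herm_left (w : C21) : Continuous fun v => herm v w := by
  simp only [herm_eq]; fun_prop

/-- The size of the Hermitian product with a fixed vector, as a function on the projective plane. -/
def hermRatio (w : C21) : ℙ ℂ C21 → ℝ :=
  Projectivization.lift (fun v => ‖herm v.1 w‖ / ‖v.1‖) <| by
    rintro ⟨a, ha⟩ ⟨b, hb⟩ t h
    simp only at h
    have ht : ‖t‖ ≠ 0 := norm_ne_zero_iff.2 fun h0 => ha (by rw [h, h0, zero_smul])
    simp only [h, herm_smul_left, norm_mul, norm_smul]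
    rw [mul_div_mul_left _ _ ht]

theorem continuous_hermRatio (w : C21) : Continuous (hermRatio w) := by
  rw [isQuotientMap_toProj.continuous_iff]
  change Continuous fun v : {v : C21 // v ≠ 0} => ‖herm v.1 w‖ / ‖v.1‖
  exact (((continuous_herm_left w).comp continuous_subtype_val).norm).div
    continuous_subtype_val.norm fun v => norm_ne_zero_iff.2 v.2

theorem hermRatio_lift (w : C21) (p : S3) : hermRatio w p.1 = ‖herm p.lift w‖ / ‖p.lift‖ := by
  conv_lhs => rw [← p.1.mk_rep]
  rfl

/-- The normalized absolute value of the product with a lift of p vanishes on the sphere only at p,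
since distinct null lines are not orthogonal. -/
instance : T2Space S3 := by
  refine ⟨fun p q hpq => separated_by_continuous (f := fun x : S3 => hermRatio p.lift x.1)
    ((continuous_hermRatio _).comp continuous_subtype_val) ?_⟩
  simp only [hermRatio_lift, herm_lift_self, norm_zero, zero_div]
  exact (div_ne_zero (norm_ne_zero_iff.2 (herm_ne_zero hpq.symm))
    (norm_ne_zero_iff.2 (lift_ne_zero q))).symm

/-! ### Rigidity of elements of PU(2,1) -/

theorem add_smul_ne_zero {p q : S3} (h : p ≠ q) (c : ℂ) : p.lift + c • q.lift ≠ 0 := by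
  intro h0
  have := LinearIndependent.pair_iff.1 (linearIndependent_lift h) 1 c (by simpa using h0)
  exact one_ne_zero this.1

/-- The factor i⟨p,q⟩ makes the two cross terms cancel. As ε varies, this traces an arc through p of
the ℂ-circle through p and q. -/
theorem herm_add_smul_self {p q : S3} (ε : ℝ) :
    herm (p.lift + (ε * (Complex.I * herm p.lift q.lift)) • q.lift)
      (p.lift + (ε * (Complex.I * herm p.lift q.lift)) • q.lift) = 0 := by
  have expand : ∀ (v w : C21) (b : ℂ), herm (v + b • w) (v + b • w) =
      herm v v + conj b * herm v w + b * herm w v + b * conj b * herm w w := by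
    intro v w b
    simp [herm_eq]; ring
  rw [expand, herm_lift_self, herm_lift_self, map_mul, map_mul, Complex.conj_I,
    Complex.conj_ofReal, ← herm_conj p.lift q.lift]
  ring

/-- An element of `PU(2,1)` which fixes a nonempty open set is the identity. -/
theorem eq_one_of_fixes_open {g : PU21} {O : Set S3} (hO : IsOpen O) (hne : O.Nonempty)
    (hg : ∀ p ∈ O, g • p = p) : g = 1 := by
  obtain ⟨_, A, rfl⟩ := g
  obtain ⟨p, hp⟩ := hne
  have hfix : ∀ x ∈ O, A • x = x := hg
  apply Subtype.ext
  ext1 q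
  change A • q = q
  by_cases hpq : p = q
  · rw [← hpq]; exact hfix p hp
  set v := p.lift with hv
  set w := q.lift with hw
  set c := Complex.I * herm v w with hc
  have hc0 : c ≠ 0 := mul_ne_zero Complex.I_ne_zero (herm_ne_zero hpq)
  set γ : ℝ → S3 := fun ε => S3.mk (v + (ε * c) • w) (add_smul_ne_zero hpq _)
    (herm_add_smul_self ε) with hγ
  have hγc : Continuous γ := by
    have h1 : Continuous fun ε : ℝ =>
        (⟨v + (ε * c) • w, add_smul_ne_zero hpq _⟩ : {v : C21 // v ≠ 0}) :=
      Continuous.subtype_mk (by fun_prop) _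
    exact (isQuotientMap_toProj.continuous.comp h1).subtype_mk _
  have hγ0 : γ 0 = p := by
    conv_rhs => rw [← S3.mk_lift p]
    simp [hγ, hv]
  have hev : ∀ᶠ ε in 𝓝 (0 : ℝ), γ ε ∈ O :=
    hγc.continuousAt.eventually_mem (hO.mem_nhds (hγ0 ▸ hp))
  obtain ⟨δ, hδ, hball⟩ := Metric.eventually_nhds_iff.1 hev
  -- Three points of the arc lie in the fixed set, so v, v + kw and v - kw are eigenvectors of A.
  have h1 : γ (δ / 2) ∈ O := hball (by simp [abs_of_pos hδ]; linarith)
  have h2 : γ (-(δ / 2)) ∈ O := hball (by simp [abs_of_pos hδ]; linarith)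
  have h0 : γ 0 ∈ O := hball (by simpa using hδ)
  have key : ∀ ε : ℝ, γ ε ∈ O → ∃ μ : ℂ, μ • (v + (ε * c) • w) =
      (A : C21 ≃ₗ[ℂ] C21) v + (ε * c) • (A : C21 ≃ₗ[ℂ] C21) w := by
    intro ε hε
    have h := hfix _ hε
    rw [hγ] at h
    simp only [smul_mk] at h
    obtain ⟨μ, hμ⟩ := S3.mk_eq_mk.1 h
    exact ⟨μ, by rw [hμ, map_add, map_smul]⟩
  obtain ⟨l, hl⟩ := key _ h0
  obtain ⟨μ, hμ⟩ := key _ h1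
  obtain ⟨ν, hν⟩ := key _ h2
  set k : ℂ := ((δ / 2 : ℝ) : ℂ) * c with hk
  have hk0 : k ≠ 0 := mul_ne_zero (by exact_mod_cast (half_pos hδ).ne') hc0
  have hk' : ((-(δ / 2) : ℝ) : ℂ) * c = -k := by rw [hk]; push_cast; ring
  rw [hk'] at hν
  simp only [Complex.ofReal_zero, zero_mul, zero_smul, add_zero] at hl
  have hli := LinearIndependent.pair_iff.1 (linearIndependent_lift hpq)
  -- Since (v + kw) + (v - kw) = 2v, independence of v and w forces the three eigenvalues to
  -- coincide; hence w is an eigenvector and q is fixed.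
  have hz := hli (μ + ν - 2 * l) ((μ - ν) * k) (by
    have : (μ + ν - 2 * l) • v + ((μ - ν) * k) • w =
        μ • (v + k • w) + ν • (v + -k • w) - (2 : ℂ) • l • v := by module
    rw [← hv, ← hw, this, hμ, hν, hl]
    module)
  have hμν : μ = ν := by
    have := (mul_eq_zero.1 hz.2).resolve_right hk0
    exact sub_eq_zero.1 this
  have hlμ : l = μ := by
    have := hz.1
    rw [← hμν] at this
    linear_combination -this / 2
  have hw' : (A : C21 ≃ₗ[ℂ] C21) w = l • w := by
    have : k • (A : C21 ≃ₗ[ℂ] C21) w = k • (l • w) := by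
      have e : k • (A : C21 ≃ₗ[ℂ] C21) w = μ • (v + k • w) - (A : C21 ≃ₗ[ℂ] C21) v := by
        rw [hμ]; module
      rw [e, ← hl, hlμ]
      module
    exact smul_right_injective _ hk0 this
  conv_lhs => rw [← S3.mk_lift q, smul_mk]
  conv_rhs => rw [← S3.mk_lift q]
  exact S3.mk_eq_mk.2 ⟨l, hw'.symm⟩

/-! ## Simplices with or without their vertices -/

section Simplex

variable {M : Type*} [TopologicalSpace M]

theorem eq_single_of_mem_stdSimplex {x : Fin 4 → ℝ} (hx : x ∈ stdSimplex ℝ (Fin 4)) {v : Fin 4}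
    (h : ∀ w, w ≠ v → x w = 0) : x = Pi.single v 1 := by
  have hv : x v = 1 := by
    rw [← hx.2, Finset.sum_eq_single v (fun w _ hw => h w hw) (by simp)]
  ext w
  by_cases hw : w = v
  · rw [hw, hv, Pi.single_eq_same]
  · rw [h w hw, Pi.single_eq_of_ne hw]

theorem mem_simplexIn_of_ne_zero {x : Fin 4 → ℝ} (hx : x ∈ stdSimplex ℝ (Fin 4)) {a b : Fin 4}
    (hab : a ≠ b) (ha : x a ≠ 0) (hb : x b ≠ 0) : x ∈ simplexIn M := by
  refine ⟨hx, Or.inr fun v hv => ?_⟩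
  rw [hv] at ha hb
  have h : ∀ c, (Pi.single v 1 : Fin 4 → ℝ) c ≠ 0 → c = v := fun c hc => by
    by_contra hcv
    exact hc (Pi.single_eq_of_ne hcv 1)
  exact hab ((h a ha).trans (h b hb).symm)

/-- Removing vertices preserves convexity because they are extreme points. This gives connected
faces in the ideal case too. -/
theorem convex_simplexIn : Convex ℝ (simplexIn M) := by
  intro x hx y hy a b ha hb hab
  have hmem := convex_stdSimplex ℝ (Fin 4) hx.1 hy.1 ha hb hab
  refine ⟨hmem, ?_⟩
  rcases hx.2 with hc | hxv
  · exact Or.inl hc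
  rcases hy.2 with hc | hyv
  · exact Or.inl hc
  refine Or.inr fun v hv => ?_
  have hzero : ∀ w, w ≠ v → a * x w = 0 ∧ b * y w = 0 := by
    intro w hw
    have h := congrFun hv w
    rw [Pi.single_eq_of_ne hw] at h
    exact (add_eq_zero_iff_of_nonneg (mul_nonneg ha (hx.1.1 w)) (mul_nonneg hb (hy.1.1 w))).1 h
  rcases ha.eq_or_lt with ha0 | ha0
  · have hb1 : b ≠ 0 := by rintro rfl; simp [← ha0] at hab
    exact hyv v (eq_single_of_mem_stdSimplex hy.1 fun w hw =>
      (mul_eq_zero.1 (hzero w hw).2).resolve_left hb1)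
  · exact hxv v (eq_single_of_mem_stdSimplex hx.1 fun w hw =>
      (mul_eq_zero.1 (hzero w hw).1).resolve_left ha0.ne')

/-- The face of the simplex opposite to a vertex. -/
def faceIn (M : Type*) [TopologicalSpace M] (f : Fin 4) : Set (Fin 4 → ℝ) :=
  {x ∈ simplexIn M | x f = 0}

theorem convex_faceIn (f : Fin 4) : Convex ℝ (faceIn M f) := by
  intro x hx y hy a b ha hb hab
  refine ⟨convex_simplexIn hx.1 hy.1 ha hb hab, ?_⟩
  simp [hx.2, hy.2]

instance (f : Fin 4) : PreconnectedSpace (faceIn M f) :=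
  Subtype.preconnectedSpace (convex_faceIn f).isPreconnected

/-- The inclusion of a face in the simplex. -/
def faceIncl (f : Fin 4) (x : faceIn M f) : simplexIn M := ⟨x.1, x.2.1⟩

theorem continuous_faceIncl (f : Fin 4) : Continuous (faceIncl (M := M) f) :=
  continuous_subtype_val.subtype_mk _

/-- The map of a simplex which permutes the barycentric coordinates. -/
def permIncl (σ : Equiv.Perm (Fin 4)) (x : simplexIn M) : simplexIn M :=
  ⟨x.1 ∘ σ.symm, ⟨fun v => x.2.1.1 _, by
    rw [← x.2.1.2]; exact Equiv.sum_comp σ.symm x.1⟩, x.2.2.imp_right fun h v hv => by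
      refine h (σ.symm v) ?_
      have : x.1 = (x.1 ∘ σ.symm) ∘ σ := by ext; simp
      rw [this, hv]
      ext w
      simp [Pi.single_apply, Equiv.eq_symm_apply]⟩

theorem continuous_permIncl (σ : Equiv.Perm (Fin 4)) : Continuous (permIncl (M := M) σ) := by
  refine Continuous.subtype_mk ?_ _
  exact continuous_pi fun v => (continuous_apply _).comp continuous_subtype_val

/-- The points of the simplex that lie on no face. -/
def interiorIn (M : Type*) [TopologicalSpace M] : Set (simplexIn M) := {x | ∀ v, x.1 v ≠ 0}

theorem isOpen_interiorIn : IsOpen (interiorIn M) := by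
  have : interiorIn M = ⋂ v, {x : simplexIn M | x.1 v ≠ 0} := by ext; simp [interiorIn]
  rw [this]
  exact isOpen_iInter_of_finite fun v =>
    isOpen_ne_fun ((continuous_apply v).comp continuous_subtype_val) continuous_const

/-- The interior of the simplex is dense. -/
theorem dense_interiorIn : Dense (interiorIn M) := by
  intro x
  set b : Fin 4 → ℝ := fun _ => 1 / 4 with hb
  have hbs : b ∈ stdSimplex ℝ (Fin 4) := ⟨fun _ => by norm_num [hb], by simp [hb]⟩
  set γ : ℝ → Fin 4 → ℝ := fun ε => (1 - ε) • x.1 + ε • b with hγ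
  have hpos : ∀ ε : ℝ, 0 < ε → ε < 1 → ∀ v, γ ε v ≠ 0 := by
    intro ε h0 h1 v
    have h2 : 0 ≤ (1 - ε) * x.1 v := mul_nonneg (by linarith) (x.2.1.1 v)
    have : 0 < γ ε v := by simp [hγ, hb]; linarith
    exact this.ne'
  have hmem : ∀ ε : ℝ, 0 < ε → ε < 1 → γ ε ∈ simplexIn M := by
    intro ε h0 h1
    exact mem_simplexIn_of_ne_zero
      (convex_stdSimplex ℝ (Fin 4) x.2.1 hbs (by linarith) h0.le (by ring))
      (a := 0) (b := 1) (by decide) (hpos ε h0 h1 0) (hpos ε h0 h1 1)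
  rw [mem_closure_iff_nhds]
  intro t ht
  obtain ⟨U, hU, hUt⟩ := mem_nhds_subtype _ _ _ |>.1 ht
  have hc : Filter.Tendsto γ (𝓝[>] 0) (𝓝 x.1) := by
    have h1 : Continuous γ := by fun_prop
    have h2 : γ 0 = x.1 := by simp [hγ]
    rw [← h2]
    exact h1.continuousAt.tendsto.mono_left nhdsWithin_le_nhds
  obtain ⟨ε, hεU, h0, h1⟩ := ((hc.eventually_mem hU).and
    (Ioo_mem_nhdsGT (zero_lt_one (α := ℝ)))).exists
  exact ⟨⟨γ ε, hmem ε h0 h1⟩, hUt hεU, hpos ε h0 h1⟩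

variable {k : ℕ} (G : Gluing k)

theorem Gluing.not_mem_interiorIn_of_rel {a b : Fin k × simplexIn M} (h : G.Rel M a b) :
    a.2 ∉ interiorIn M ∧ b.2 ∉ interiorIn M := by
  obtain ⟨f, h1, -, h2⟩ := h
  exact ⟨fun ha => ha f h1, fun hb => hb _ ((h2 f).trans h1)⟩

/-- A point of the interior of a tetrahedron is identified with no other point. -/
theorem Gluing.eq_of_mk_eq {a b : Fin k × simplexIn M} (ha : a.2 ∈ interiorIn M)
    (h : Quot.mk (G.Rel M) a = Quot.mk _ b) : a = b := by
  have key : ∀ a b, Relation.EqvGen (G.Rel M) a b →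
      (a.2 ∈ interiorIn M → a = b) ∧ (b.2 ∈ interiorIn M → a = b) := by
    intro a b h
    induction h with
    | rel a b h =>
      have := G.not_mem_interiorIn_of_rel h
      exact ⟨fun h => (this.1 h).elim, fun h => (this.2 h).elim⟩
    | refl a => exact ⟨fun _ => rfl, fun _ => rfl⟩
    | symm a b _ ih => exact ⟨fun h => (ih.2 h).symm, fun h => (ih.1 h).symm⟩
    | trans a b c _ _ ih1 ih2 =>
      refine ⟨fun h => ?_, fun h => ?_⟩
      · have e := ih1.1 h
        exact e.trans (ih2.1 (e ▸ h))
      · have e := ih2.2 h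
        exact (ih1.2 (e ▸ h)).trans e
  exact (key a b (Quot.eqvGen_exact h)).1 ha

/-- The image in the glued space of an open subset of the interior of a tetrahedron is open. -/
theorem Gluing.isOpen_image_mk (i : Fin k) {V : Set (simplexIn M)} (hV : IsOpen V)
    (hVi : V ⊆ interiorIn M) :
    IsOpen ((fun x => (Quot.mk _ (i, x) : G.Realization M)) '' V) := by
  have hq : Topology.IsQuotientMap (Quot.mk (G.Rel M)) := isQuotientMap_quot_mk
  rw [← hq.isOpen_preimage]
  have : Quot.mk (G.Rel M) ⁻¹' ((fun x => (Quot.mk _ (i, x) : G.Realization M)) '' V) =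
      {i} ×ˢ V := by
    ext ⟨j, y⟩
    constructor
    · rintro ⟨x, hx, h⟩
      obtain ⟨rfl, rfl⟩ := Prod.mk.inj (G.eq_of_mk_eq (a := (i, x)) (hVi hx) h)
      exact ⟨rfl, hx⟩
    · rintro ⟨rfl, hy⟩
      exact ⟨y, hy, rfl⟩
  rw [this]
  exact (isOpen_discrete _).prod hV

end Simplex

/-! ## Coordinate changes and developments -/

section Development

open Set

/-- A chart carries a neighbourhood of m onto an open set fixed by g'⁻¹g, so rigidity applies. -/
theorem transition_unique {M : Type*} [TopologicalSpace M] {e : OpenPartialHomeomorph M S3} {m : M} (hm : m ∈ e.source)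
    {g g' : PU21} (h : ∀ᶠ m' in 𝓝 m, g • e m' = g' • e m') : g = g' := by
  obtain ⟨U, hU, hUo, hmU⟩ := eventually_nhds_iff.1 h
  have hO : IsOpen (e '' (U ∩ e.source)) :=
    e.isOpen_image_of_subset_source (hUo.inter e.open_source) inter_subset_right
  have : g'⁻¹ * g = 1 := by
    refine eq_one_of_fixes_open hO ⟨e m, m, ⟨hmU, hm⟩, rfl⟩ ?_
    rintro _ ⟨m', ⟨h1, h2⟩, rfl⟩
    rw [mul_smul, hU m' h1, inv_smul_smul]
  exact (inv_mul_eq_one.1 this).symm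

variable {M : Type*} [TopologicalSpace M] [ChartedSpace S3 M]

/-- The coordinate changes of a spherical CR manifold are given locally by `PU(2,1)`. -/
theorem exists_transition {e e' : OpenPartialHomeomorph M S3} (he : e ∈ crGroupoid.maximalAtlas M)
    (he' : e' ∈ crGroupoid.maximalAtlas M) {m : M} (hm : m ∈ e.source) (hm' : m ∈ e'.source) :
    ∃ g : PU21, ∀ᶠ m' in 𝓝 m, e' m' = g • e m' := by
  have h := StructureGroupoid.compatible_of_mem_maximalAtlas he he'
  have hsrc : e m ∈ (e.symm ≫ₕ e').source := by
    rw [OpenPartialHomeomorph.trans_source]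
    exact ⟨e.map_source hm, by simpa [e.left_inv hm] using hm'⟩
  obtain ⟨g, hg⟩ : ∃ g : PU21, ∀ᶠ y in 𝓝 (e m), (e.symm ≫ₕ e') y = g • y := h (e m) hsrc
  refine ⟨g, ?_⟩
  filter_upwards [(e.continuousAt hm).eventually hg, e.open_source.mem_nhds hm] with m' h1 h2
  rwa [OpenPartialHomeomorph.coe_trans, Function.comp_apply, e.left_inv h2] at h1

namespace CRTriangulation

variable (T : CRTriangulation M)

/-- The embedding of a tetrahedron in the manifold. -/
def toManifold (i : Fin T.k) (x : simplexIn M) : M := T.homeo (Quot.mk _ (i, x))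

theorem continuous_toManifold (i : Fin T.k) : Continuous (T.toManifold i) :=
  T.homeo.continuous.comp (continuous_quot_mk.comp (by fun_prop))

theorem isOpen_image_toManifold (i : Fin T.k) {V : Set (simplexIn M)} (hV : IsOpen V)
    (hVi : V ⊆ interiorIn M) : IsOpen (T.toManifold i '' V) := by
  have := T.homeo.isOpenMap _ (T.gluing.isOpen_image_mk i hV hVi)
  rwa [image_image] at this

/-- A chart of the spherical CR structure which gives the development of a tetrahedron near a
point. -/
def IsDevelopingChart (i : Fin T.k) (x : simplexIn M) (e : OpenPartialHomeomorph M S3) : Prop :=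
  e ∈ crGroupoid.maximalAtlas M ∧ T.toManifold i x ∈ e.source ∧
    ∀ᶠ y : simplexIn M in 𝓝 x, T.dev i y = e (T.toManifold i y)

variable {T}

theorem IsDevelopingChart.eventually {i : Fin T.k} {x : simplexIn M}
    {e : OpenPartialHomeomorph M S3} (h : T.IsDevelopingChart i x e) :
    ∀ᶠ y in 𝓝 x, T.IsDevelopingChart i y e := by
  filter_upwards [(T.continuous_toManifold i).continuousAt.eventually_mem
    (e.open_source.mem_nhds h.2.1), h.2.2.eventually_nhds] with y h1 h2
  exact ⟨h.1, h1, h2⟩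

/-- Two charts which give the development of a tetrahedron near a point have the same germ. -/
theorem IsDevelopingChart.eventually_eq {i : Fin T.k} {x : simplexIn M}
    {e e' : OpenPartialHomeomorph M S3} (h : T.IsDevelopingChart i x e)
    (h' : T.IsDevelopingChart i x e') : ∀ᶠ m in 𝓝 (T.toManifold i x), e' m = e m := by
  obtain ⟨g, hg⟩ := exists_transition h.1 h'.1 h.2.1 h'.2.1
  have hev : ∀ᶠ y : simplexIn M in 𝓝 x, T.toManifold i y ∈ e.source ∧
      g • e (T.toManifold i y) = e (T.toManifold i y) := by
    filter_upwards [(T.continuous_toManifold i).continuousAt.eventually hg, h.2.2, h'.2.2,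
      (T.continuous_toManifold i).continuousAt.eventually_mem (e.open_source.mem_nhds h.2.1)]
      with y h1 h2 h3 h4
    exact ⟨h4, by rw [← h1, ← h3, h2]⟩
  obtain ⟨U, hU, hUo, hxU⟩ := eventually_nhds_iff.1 hev
  -- The point x may lie on a face, where neighbourhoods in the simplex need not have open image in
  -- M. Nearby interior points do supply an open set fixed by g.
  obtain ⟨y, hyU, hyi⟩ := dense_interiorIn.inter_open_nonempty U hUo ⟨x, hxU⟩
  have hsub : T.toManifold i '' (U ∩ interiorIn M) ⊆ e.source := by
    rintro _ ⟨z, hz, rfl⟩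
    exact (hU z hz.1).1
  have hO : IsOpen (e '' (T.toManifold i '' (U ∩ interiorIn M))) :=
    e.isOpen_image_of_subset_source
      (T.isOpen_image_toManifold i (hUo.inter isOpen_interiorIn) inter_subset_right) hsub
  have h1 : g = 1 := by
    refine eq_one_of_fixes_open hO ⟨_, _, ⟨y, ⟨hyU, hyi⟩, rfl⟩, rfl⟩ ?_
    rintro _ ⟨_, ⟨z, hz, rfl⟩, rfl⟩
    exact (hU z hz.1).2
  filter_upwards [hg] with m hm
  rw [hm, h1, one_smul]

variable (T)

/-! ### Comparison of developments along a common face -/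

theorem toManifold_permIncl (F : Fin T.k × Fin 4) (x : faceIn M F.2) :
    T.toManifold (T.gluing.pair F).1 (permIncl (T.gluing.perm F) (faceIncl F.2 x)) =
      T.toManifold F.1 (faceIncl F.2 x) := by
  refine congrArg T.homeo (Quot.sound ?_).symm
  refine ⟨F.2, x.2.2, rfl, fun v => ?_⟩
  simp [permIncl, faceIncl]

/-- The element `g` relates the developments of two glued tetrahedra at a point of the common
face. -/
def IsGluingMap (F : Fin T.k × Fin 4) (x : faceIn M F.2) (g : PU21) : Prop :=
  ∃ e e' : OpenPartialHomeomorph M S3, T.IsDevelopingChart F.1 (faceIncl F.2 x) e ∧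
    T.IsDevelopingChart (T.gluing.pair F).1 (permIncl (T.gluing.perm F) (faceIncl F.2 x)) e' ∧
    ∀ᶠ m in 𝓝 (T.toManifold F.1 (faceIncl F.2 x)), e' m = g • e m

variable {T}

theorem exists_isGluingMap (F : Fin T.k × Fin 4) (x : faceIn M F.2) :
    ∃ g, T.IsGluingMap F x g := by
  obtain ⟨e, he1, he2, he3⟩ := T.dev_chart F.1 (faceIncl F.2 x)
  obtain ⟨e', he1', he2', he3'⟩ := T.dev_chart (T.gluing.pair F).1
    (permIncl (T.gluing.perm F) (faceIncl F.2 x))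
  have hs : T.toManifold F.1 (faceIncl F.2 x) ∈ e'.source := by
    rw [← toManifold_permIncl]; exact he2'
  obtain ⟨g, hg⟩ := exists_transition he1 he1' he2 hs
  exact ⟨g, e, e', ⟨he1, he2, he3⟩, ⟨he1', he2', he3'⟩, hg⟩

/-- The germs of the developing charts on both sides are determined by the developments, and a
coordinate change determines its element of PU(2,1). -/
theorem IsGluingMap.unique {F : Fin T.k × Fin 4} {x : faceIn M F.2} {g g' : PU21}
    (h : T.IsGluingMap F x g) (h' : T.IsGluingMap F x g') : g = g' := by
  obtain ⟨e₁, e₁', h₁, h₁', hg⟩ := h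
  obtain ⟨e₂, e₂', h₂, h₂', hg'⟩ := h'
  have f := h₁.eventually_eq h₂
  have f' := h₁'.eventually_eq h₂'
  rw [toManifold_permIncl] at f'
  refine transition_unique h₁.2.1 ?_
  filter_upwards [f, f', hg, hg'] with m a1 a2 a3 a4
  rw [← a3, ← a1, ← a4, a2]

theorem IsGluingMap.eventually {F : Fin T.k × Fin 4} {x : faceIn M F.2} {g : PU21}
    (h : T.IsGluingMap F x g) : ∀ᶠ y in 𝓝 x, T.IsGluingMap F y g := by
  obtain ⟨e, e', he, he', hg⟩ := h
  have c1 := continuous_faceIncl (M := M) F.2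
  have c2 := (continuous_permIncl (M := M) (T.gluing.perm F)).comp c1
  filter_upwards [c1.continuousAt.eventually he.eventually,
    c2.continuousAt.eventually he'.eventually,
    ((T.continuous_toManifold F.1).comp c1).continuousAt.eventually hg.eventually_nhds]
    with y h1 h2 h3
  exact ⟨e, e', h1, h2, h3⟩

/-- The developments of two glued tetrahedra differ on the common face by an element of
`PU(2,1)`. -/
theorem exists_gluing_element (F : Fin T.k × Fin 4) :
    ∃ g : PU21, ∀ x : faceIn M F.2,
      T.dev (T.gluing.pair F).1 (x.1 ∘ (T.gluing.perm F).symm) = g • T.dev F.1 x.1 := by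
  choose G hG using exists_isGluingMap (T := T) F
  -- An element valid at x remains valid near x, so uniqueness makes the choice locally constant,
  -- hence constant on the connected face.
  have hconst : IsLocallyConstant G := by
    rw [IsLocallyConstant.iff_eventually_eq]
    intro x
    filter_upwards [(hG x).eventually] with y hy
    exact (hG y).unique hy
  rcases isEmpty_or_nonempty (faceIn M F.2) with hE | ⟨⟨x₀⟩⟩
  · exact ⟨1, fun x => (hE.false x).elim⟩
  refine ⟨G x₀, fun x => ?_⟩
  obtain ⟨e, e', he, he', hg⟩ := hG x
  have h1 := he.2.2.self_of_nhds
  have h2 := he'.2.2.self_of_nhds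
  rw [toManifold_permIncl, hg.self_of_nhds, ← h1,
    hconst.apply_eq_of_preconnectedSpace x x₀] at h2
  exact h2

/-- The vertices of two glued faces differ by an element of `PU(2,1)`. -/
theorem exists_gluing_element_vertices (F : Fin T.k × Fin 4) :
    ∃ g : PU21, ∀ v, v ≠ F.2 → (T.vertices (T.gluing.pair F).1).1 (T.gluing.perm F v) =
      g • (T.vertices F.1).1 v := by
  obtain ⟨g, hg⟩ := exists_gluing_element (T := T) F
  refine ⟨g, fun v hv => ?_⟩
  obtain ⟨i, f⟩ := F
  simp only at hv hg ⊢
  set σ := T.gluing.perm (i, f) with hσ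
  set j := (T.gluing.pair (i, f)).1 with hj
  -- This is the barycentre of the face. An ideal vertex is not in the face, so v is approached
  -- along the segment towards b. The developments are continuous on the closed simplex, and limits
  -- in the sphere are unique.
  set b : Fin 4 → ℝ := fun w => if w = f then 0 else 1 / 3 with hb
  have hbs : b ∈ stdSimplex ℝ (Fin 4) := by
    refine ⟨fun w => ?_, ?_⟩
    · simp only [hb]; split_ifs <;> norm_num
    · have h : ∀ w, b w = 1 / 3 - if w = f then 1 / 3 else 0 := fun w => by
        simp only [hb]; split_ifs <;> norm_num
      simp only [h, Finset.sum_sub_distrib, Finset.sum_ite_eq', Finset.mem_univ, if_true]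
      norm_num
  have hvs : (Pi.single v 1 : Fin 4 → ℝ) ∈ stdSimplex ℝ (Fin 4) := single_mem_stdSimplex ℝ v
  set γ : ℝ → Fin 4 → ℝ := fun ε => (1 - ε) • (Pi.single v 1 : Fin 4 → ℝ) + ε • b with hγ
  have hγc : Continuous γ := by fun_prop
  have hγ0 : γ 0 = Pi.single v 1 := by simp [hγ]
  have hγs : ∀ ε ∈ Ioo (0 : ℝ) 1, γ ε ∈ stdSimplex ℝ (Fin 4) := fun ε hε =>
    convex_stdSimplex ℝ (Fin 4) hvs hbs (by linarith [hε.2]) hε.1.le (by ring)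
  have hγf : ∀ ε ∈ Ioo (0 : ℝ) 1, γ ε ∈ faceIn M f := by
    intro ε hε
    have hpos : ∀ w, w ≠ f → γ ε w ≠ 0 := by
      intro w hw
      have h0 : 0 ≤ (1 - ε) * (Pi.single v 1 : Fin 4 → ℝ) w :=
        mul_nonneg (by linarith [hε.2]) (hvs.1 w)
      have : 0 < γ ε w := by
        simp only [hγ, hb, Pi.add_apply, Pi.smul_apply, smul_eq_mul, if_neg hw]
        linarith [hε.1]
      exact this.ne'
    obtain ⟨w₁, w₂, h12, h1, h2⟩ : ∃ w₁ w₂ : Fin 4, w₁ ≠ w₂ ∧ w₁ ≠ f ∧ w₂ ≠ f :=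
      (by decide : ∀ f : Fin 4, ∃ w₁ w₂ : Fin 4, w₁ ≠ w₂ ∧ w₁ ≠ f ∧ w₂ ≠ f) f
    refine ⟨mem_simplexIn_of_ne_zero (hγs ε hε) h12 (hpos _ h1) (hpos _ h2), ?_⟩
    simp [hγ, hb, Pi.single_eq_of_ne hv.symm]
  have hmem : Ioo (0 : ℝ) 1 ∈ 𝓝[>] (0 : ℝ) := Ioo_mem_nhdsGT zero_lt_one
  have hlim : Filter.Tendsto γ (𝓝[>] 0) (𝓝[stdSimplex ℝ (Fin 4)] (Pi.single v 1)) := by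
    refine tendsto_nhdsWithin_iff.2 ⟨?_, ?_⟩
    · rw [← hγ0]
      exact hγc.continuousAt.tendsto.mono_left nhdsWithin_le_nhds
    · filter_upwards [hmem] with ε hε using hγs ε hε
  have hperm : (Pi.single v 1 : Fin 4 → ℝ) ∘ σ.symm = Pi.single (σ v) 1 := by
    ext w
    simp [Pi.single_apply, Equiv.symm_apply_eq]
  have hlim' : Filter.Tendsto (fun ε => γ ε ∘ σ.symm) (𝓝[>] 0)
      (𝓝[stdSimplex ℝ (Fin 4)] (Pi.single (σ v) 1)) := by
    refine tendsto_nhdsWithin_iff.2 ⟨?_, ?_⟩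
    · rw [← hperm, ← hγ0]
      have : Continuous fun ε => γ ε ∘ σ.symm :=
        continuous_pi fun w => (continuous_apply (σ.symm w)).comp hγc
      exact this.continuousAt.tendsto.mono_left nhdsWithin_le_nhds
    · filter_upwards [hmem] with ε hε
      exact ⟨fun w => (hγs ε hε).1 _, by
        rw [← (hγs ε hε).2]; exact Equiv.sum_comp σ.symm (γ ε)⟩
  have l1 := (continuous_smul_S3 g).continuousAt.tendsto.comp
    ((T.dev_continuous i _ hvs).tendsto.comp hlim)
  have l2 := (T.dev_continuous j _ (single_mem_stdSimplex ℝ (σ v))).tendsto.comp hlim'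
  refine tendsto_nhds_unique_of_eventuallyEq l2 l1 ?_
  filter_upwards [hmem] with ε hε
  exact hg ⟨γ ε, hγf ε hε⟩

theorem two_mul_volume_fundamentalClass :
    2 * blochWignerHom (configHom T.fundamentalClass) =
      ∑ F : Fin T.k × Fin 4, signedFace (T.vertices F.1).1 F.2 := by
  simp only [fundamentalClass, map_sum, configHom_configClass]
  rw [Finset.mul_sum, Fintype.sum_prod_type]
  exact Finset.sum_congr rfl fun i _ => two_mul_blochWignerHom_beta_eq_sum _

/-- The pairing is an involution of the set of all faces that negates the face contributions, so
their sum equals its own negative. -/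
theorem volume_fundamentalClass_eq_zero :
    blochWignerHom (configHom T.fundamentalClass) = 0 := by
  set φ : Fin T.k × Fin 4 → ℝ := fun F => signedFace (T.vertices F.1).1 F.2 with hφ
  have hpair : ∀ F, φ (T.gluing.pair F) = -φ F := by
    intro F
    obtain ⟨g, hg⟩ := exists_gluing_element_vertices (T := T) F
    have := signedFace_of_gluing (T.gluing.perm_sign F) g hg
    rwa [T.gluing.perm_opposite] at this
  have hsum : ∑ F, φ F = -∑ F, φ F := by
    conv_lhs => rw [← Equiv.sum_comp (Function.Involutive.toPerm _ T.gluing.pair_pair) φ]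
    rw [← Finset.sum_neg_distrib]
    exact Finset.sum_congr rfl fun F _ => hpair F
  have h2 := two_mul_volume_fundamentalClass (T := T)
  linarith

end CRTriangulation

end Development

end SphericalCR

end

open SphericalCR

theorem mainTheorem1 (M : Type*) [TopologicalSpace M] [T2Space M] [SecondCountableTopology M]
    [ChartedSpace S3 M] [HasGroupoid M crGroupoid] (T : CRTriangulation M) :
    ∃ (D : PreBloch ℂ →+ ℝ) (c : ConfigQuotient →+ PreBloch ℂ),
      (∀ z : Gen ℂ, D (PreBloch.of z) = blochWigner z) ∧
      (∀ p : GenericTuple 4, c (configClass p) = beta p) ∧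
      D (c T.fundamentalClass) = 0 :=
  ⟨blochWignerHom, configHom, blochWignerHom_of, configHom_configClass,
    CRTriangulation.volume_fundamentalClass_eq_zero⟩
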